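/- For a finite graph $H$ let $|H|$ be its number of vertices, $\alpha(H)$ its independence number and $\gamma_H=|H|-\alpha(H)-1$. Let $\mathbb{H}$ be a nonempty finite family of finite simple graphs such that $\gamma_{\mathbb{H}}:=\min_{H\in\mathbb{H}}\gamma_H\ge 1$. A graph is $\mathbb{H}$-subdivision-free if, for every $H\in\mathbb{H}$, none of its subgraphs is a subdivision of $H$ (a graph obtained from $H$ by replacing some edges by internally vertex-disjoint paths). The spectral radius $\rho(G)$ is the largest modulus of an eigenvalue of the adjacency matrix of $G$, and $B_{s,t}=K_s\vee tK_1$ is the join of a clique on $s$ vertices with an independent set of $t$ vertices. Then there is an integer $N=N(\mathbb{H})$ such that for every $n\ge N$, every graph $G$ that has the maximum spectral radius among all $\mathbb{H}$-subdivision-free graphs on $n$ vertices contains a spanning subgraph isomorphic to $B_{\gamma_{\mathbb{H}},\,n-\gamma_{\mathbb{H}}}$. -/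

import Mathlib

open scoped ENNReal

namespace SubdivSpectral

/-- A model of `H` in `G`: an injective choice of branch vertices `branch v`, and for every edge
`uv` of `H` a path of `G` from `branch u` to `branch v` (the path read from `v` to `u` is the
reverse of the path read from `u` to `v`, so there is one path per edge), such that the paths are
pairwise internally vertex-disjoint and have no branch vertex in their interior. The union of these
vertices and paths is exactly a subgraph of `G` that is a subdivision of `H`. -/
structure SubdivisionModel {V W : Type*} (H : SimpleGraph V) (G : SimpleGraph W) where
  branch : V ↪ W
  path : ∀ u v : V, H.Adj u v → G.Walk (branch u) (branch v)
  isPath : ∀ (u v : V) (h : H.Adj u v), (path u v h).IsPath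
  path_symm : ∀ (u v : V) (h : H.Adj u v), path v u h.symm = (path u v h).reverse
  /-- A branch vertex on the path of the edge `uv` is one of its two ends. -/
  branch_mem : ∀ (u v : V) (h : H.Adj u v) (w : V),
    branch w ∈ (path u v h).support → w = u ∨ w = v
  /-- Paths of different edges have only branch vertices in common. -/
  disjoint : ∀ (u v : V) (h : H.Adj u v) (u' v' : V) (h' : H.Adj u' v'),
    s(u, v) ≠ s(u', v') → ∀ x : W, x ∈ (path u v h).support → x ∈ (path u' v' h').support →
      ∃ w : V, x = branch w

/-- `G` contains a subdivision of `H` as a subgraph. -/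
def ContainsSubdivision {V W : Type*} (H : SimpleGraph V) (G : SimpleGraph W) : Prop :=
  Nonempty (SubdivisionModel H G)

/-- `G` contains no subdivision of any member of the family `H`. -/
def SubdivisionFree {ι : Type*} {V : ι → Type*} (H : ∀ i, SimpleGraph (V i))
    {W : Type*} (G : SimpleGraph W) : Prop :=
  ∀ i, ¬ ContainsSubdivision (H i) G

open Classical in
/-- The spectral radius of a graph: the largest modulus of an eigenvalue of its (real symmetric)
adjacency matrix. -/
noncomputable def rho {W : Type*} [Fintype W] (G : SimpleGraph W) : ℝ≥0∞ :=
  spectralRadius ℝ (G.adjMatrix ℝ)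

/-- `G` belongs to `SPEX(n, H_sub)`: it is `H`-subdivision-free and has the maximum spectral radius
among all `H`-subdivision-free graphs with `n` vertices. -/
def IsSpectralExtremal {ι : Type*} {V : ι → Type*} (H : ∀ i, SimpleGraph (V i))
    {n : ℕ} (G : SimpleGraph (Fin n)) : Prop :=
  SubdivisionFree H G ∧ ∀ G' : SimpleGraph (Fin n), SubdivisionFree H G' → rho G' ≤ rho G

/-- `γ_H = |H| - α(H) - 1`. The subtraction is truncated, which matters only for graphs without
edges (value `0` instead of `-1`). -/
noncomputable def gammaGraph {V : Type*} [Fintype V] (H : SimpleGraph V) : ℕ :=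
  Fintype.card V - H.indepNum - 1

/-- The minimum of `γ_H` over the members `H` of the family (and `0` for the empty family). -/
noncomputable def gammaFamily {ι : Type*} {V : ι → Type*} [∀ i, Fintype (V i)]
    (H : ∀ i, SimpleGraph (V i)) : ℕ :=
  sInf (Set.range fun i => gammaGraph (H i))

/-- The generalized book `B_{s,t}`, the join of a clique on `s` vertices with an independent set of
`t` vertices. -/
def generalizedBook (s t : ℕ) : SimpleGraph (Fin s ⊕ Fin t) :=
  ((⊤ : SimpleGraph (Fin s)) ⊕g (⊥ : SimpleGraph (Fin t))) ⊔
    completeBipartiteGraph (Fin s) (Fin t)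

end SubdivSpectral

/-! Let G be extremal with spectral radius λ, let x be a nonnegative eigenvector of maximum 1, and
write γ for the minimum of γ_H. A graph containing a subdivision of H has no vertex cover smaller
than those of H, so the book with γ pages' spine vertices is admissible and λ² ≥ γ(n-γ). Conversely,
γ+1 vertices with many common neighbours give a subdivision of the member attaining γ, so G has no
such configuration; and by Mader's theorem every vertex set of G spans only linearly many edges.

Now count 2-walks: λ² x_u is the sum of x_w over 2-walks u, v, w. Sparsity leaves boundedly many
entries above a threshold, and all but boundedly many v see at most γ of those. Since λ² is at least
about γn, this is nearly tight, which produces γ hubs L with entries near 1 and degrees near n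
(`exists_hubs`). All other entries are tiny.

To see that hubs miss nothing, make L a clique and give a vertex v and a bounded set R of common
neighbours of L exactly the neighbourhood L (`twinGraph`). A subdivision in the new graph can be
moved back to G (`ContainsSubdivision.of_twins`): used twins are exchanged for vertices of R, and
edges inside L become detours through R. For this the vertices of R must lose their other edges, so
that they are interchangeable. The loss is small, because R has bounded degree and non-hub entries
are tiny. If a hub missed a vertex, a suitable v (`exists_light_exceptional`, or a common neighbour
if only an edge inside L is missing) would gain more than this loss in the Rayleigh quotient,
contradicting extremality. -/

namespace SubdivSpectral

/-! ### Subdivisions, vertex covers and twins -/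

/-- A description of a subdivision of `H` in `G` by its branch vertices `b` and, for every edge `e`
of `H`, a set `I e` that holds the interior of a walk replacing `e`. -/
structure IsSubdivisionSystem {V W : Type*} (H : SimpleGraph V) (G : SimpleGraph W)
    (b : V → W) (I : Sym2 V → Set W) : Prop where
  injective : Function.Injective b
  branch_notMem : ∀ e v, b v ∉ I e
  disjoint : ∀ e e', e ≠ e' → Disjoint (I e) (I e')
  exists_walk : ∀ u v, H.Adj u v → ∃ p : G.Walk (b u) (b v),
    ∀ x ∈ p.support, x = b u ∨ x = b v ∨ x ∈ I s(u, v)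

/-- Shortcutting a walk to a path only shrinks its support, so paths may be replaced by walks
confined to disjoint sets. All later constructions of subdivisions go through this. -/
theorem IsSubdivisionSystem.containsSubdivision {V W : Type*} {H : SimpleGraph V}
    {G : SimpleGraph W} {b : V → W} {I : Sym2 V → Set W} (h : IsSubdivisionSystem H G b I) :
    ContainsSubdivision H G := by
  classical
  -- An arbitrary order selects one orientation per edge; the other path is its reverse, as
  -- `path_symm` requires.
  let : LinearOrder V := IsWellOrder.linearOrder WellOrderingRel
  choose p hp using h.exists_walk
  let path : ∀ u v : V, H.Adj u v → G.Walk (b u) (b v) := fun u v huv =>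
    if u < v then (p u v huv).bypass else (p v u huv.symm).bypass.reverse
  have hsupp : ∀ u v huv, ∀ x ∈ (path u v huv).support, x = b u ∨ x = b v ∨ x ∈ I s(u, v) := by
    intro u v huv x hx
    simp only [path] at hx
    split_ifs at hx
    · exact hp u v huv x ((p u v huv).support_bypass_subset_support hx)
    · rw [SimpleGraph.Walk.support_reverse, List.mem_reverse] at hx
      have := hp v u huv.symm x ((p v u huv.symm).support_bypass_subset_support hx)
      rw [Sym2.eq_swap]
      tauto
  refine ⟨⟨⟨b, h.injective⟩, path, ?_, ?_, ?_, ?_⟩⟩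
  · intro u v huv
    simp only [path]
    split_ifs
    · exact SimpleGraph.Walk.bypass_isPath _
    · exact (SimpleGraph.Walk.bypass_isPath _).reverse
  · intro u v huv
    simp only [path]
    rcases lt_or_gt_of_ne huv.ne with h1 | h1
    · rw [if_neg h1.le.not_gt, if_pos h1]
    · rw [if_pos h1, if_neg h1.le.not_gt, SimpleGraph.Walk.reverse_reverse]
  · intro u v huv w hw
    rcases hsupp u v huv _ hw with h1 | h1 | h1
    · exact Or.inl (h.injective h1)
    · exact Or.inr (h.injective h1)
    · exact absurd h1 (h.branch_notMem _ _)
  · intro u v huv u' v' huv' hne x hx hx'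
    rcases hsupp u v huv _ hx with h1 | h1 | h1
    · exact ⟨u, h1⟩
    · exact ⟨v, h1⟩
    rcases hsupp u' v' huv' _ hx' with h2 | h2 | h2
    · exact ⟨u', h2⟩
    · exact ⟨v', h2⟩
    exact absurd h2 (Set.disjoint_left.mp (h.disjoint _ _ hne) h1)

/-- The inner vertices of the path that replaces the edge `e`. -/
def SubdivisionModel.interior {V W : Type*} {H : SimpleGraph V} {G : SimpleGraph W}
    (M : SubdivisionModel H G) (e : Sym2 V) : Set W :=
  {x | x ∉ Set.range M.branch ∧ ∃ u v, ∃ h : H.Adj u v, e = s(u, v) ∧ x ∈ (M.path u v h).support}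

theorem SubdivisionModel.isSubdivisionSystem {V W : Type*} {H : SimpleGraph V} {G : SimpleGraph W}
    (M : SubdivisionModel H G) : IsSubdivisionSystem H G M.branch M.interior where
  injective := M.branch.injective
  branch_notMem e v hv := hv.1 ⟨v, rfl⟩
  disjoint e e' hne := by
    rw [Set.disjoint_left]
    rintro x ⟨hx, u, v, h, rfl, h1⟩ ⟨-, u', v', h', rfl, h2⟩
    obtain ⟨w, rfl⟩ := M.disjoint u v h u' v' h' hne x h1 h2
    exact hx ⟨w, rfl⟩
  exists_walk u v h := by
    refine ⟨M.path u v h, fun x hx => ?_⟩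
    by_cases hb : x ∈ Set.range M.branch
    · obtain ⟨w, rfl⟩ := hb
      rcases M.branch_mem u v h w hx with rfl | rfl
      · exact Or.inl rfl
      · exact Or.inr (Or.inl rfl)
    · exact Or.inr (Or.inr ⟨hb, u, v, h, rfl, hx⟩)

/-- A graph that contains a subdivision of `H` has no vertex cover smaller than those of `H`. -/
theorem ContainsSubdivision.card_le_indepNum_add_card {V W : Type*} [Fintype V]
    {H : SimpleGraph V} {G : SimpleGraph W} (hH : ContainsSubdivision H G) (L : Finset W)
    (hL : ∀ u v, G.Adj u v → u ∈ L ∨ v ∈ L) : Fintype.card V ≤ H.indepNum + L.card := by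
  classical
  obtain ⟨M⟩ := hH
  have hM := M.isSubdivisionSystem
  rcases isEmpty_or_nonempty V with hV | ⟨⟨v0⟩⟩
  · simp
  -- Pull a cover back to `H`: a branch vertex goes to its preimage, an inner vertex to an end of
  -- its edge. Each path has an edge, hence a vertex in `L`, so the image of `L` covers `H`.
  have hex : ∀ x : W, ∃ w : V, (∀ v, x = M.branch v → w = v) ∧
      ∀ u v, x ∈ M.interior s(u, v) → w = u ∨ w = v := by
    intro x
    by_cases h1 : ∃ v, x = M.branch v
    · obtain ⟨v, rfl⟩ := h1
      exact ⟨v, fun w hw => hM.injective hw, fun a b h => absurd h (hM.branch_notMem _ _)⟩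
    by_cases h2 : ∃ e, x ∈ M.interior e
    · obtain ⟨e, he⟩ := h2
      induction e using Sym2.ind with | _ u v => ?_
      refine ⟨u, fun v hv => absurd ⟨v, hv⟩ h1, fun a b h => ?_⟩
      by_contra hne
      refine Set.disjoint_left.mp (hM.disjoint s(u, v) s(a, b) ?_) he h
      rw [Ne, Sym2.eq_iff]
      tauto
    · exact ⟨v0, fun v hv => absurd ⟨v, hv⟩ h1, fun a b h => absurd ⟨_, h⟩ h2⟩
  choose f hf1 hf2 using hex
  have hind : H.IsIndepSet ((L.image f)ᶜ : Finset V) := by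
    intro u hu v hv _ huv
    simp only [Finset.coe_compl, Set.mem_compl_iff, Finset.mem_coe, Finset.mem_image,
      not_exists, not_and] at hu hv
    obtain ⟨p, hp⟩ := hM.exists_walk u v huv
    have : ∃ x ∈ p.support, x ∈ L := by
      have hne : M.branch u ≠ M.branch v := fun h => huv.ne (hM.injective h)
      clear hp
      generalize M.branch u = a, M.branch v = c at p hne
      cases p with
      | nil => exact absurd rfl hne
      | cons h q =>
        rcases hL _ _ h with h1 | h1
        · exact ⟨_, by simp, h1⟩
        · exact ⟨_, by simp, h1⟩
    obtain ⟨x, hx, hxL⟩ := this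
    rcases hp x hx with h | h | h
    · exact hu x hxL (hf1 x u h)
    · exact hv x hxL (hf1 x v h)
    · rcases hf2 x u v h with h | h
      · exact hu x hxL h
      · exact hv x hxL h
  have h1 := hind.card_le_indepNum
  have h2 : (L.image f).card ≤ L.card := Finset.card_image_le
  rw [Finset.card_compl] at h1
  omega

/-- If every vertex of `S` is joined to `φ c` for all `c` in a vertex cover of `H`, and `S` is
large, then there is a subdivision of `H`. -/
theorem containsSubdivision_of_common_neighbors {V W : Type*} [Fintype V] [DecidableEq V]
    {H : SimpleGraph V} {G : SimpleGraph W} (C : Finset V)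
    (hC : ∀ u v, H.Adj u v → u ∈ C ∨ v ∈ C) (φ : V → W) (hφ : Set.InjOn φ C) (S : Finset W)
    (hS : ∀ s ∈ S, ∀ c ∈ C, G.Adj (φ c) s)
    (hcard : Fintype.card (V ⊕ Sym2 V) ≤ S.card) : ContainsSubdivision H G := by
  classical
  -- Reserve distinct vertices of `S` for the branch vertices outside `C` and for the midpoints of
  -- the length-two paths that replace edges inside `C`.
  obtain ⟨g⟩ : Nonempty (V ⊕ Sym2 V ↪ S) :=
    Function.Embedding.nonempty_of_card_le (by simpa using hcard)
  have hg : ∀ z, ∀ c ∈ C, G.Adj (φ c) (g z) := fun z c hc => hS _ (g z).2 c hc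
  have hinj : ∀ z z', (g z : W) = g z' → z = z' := fun z z' h => g.injective (Subtype.ext h)
  let b : V → W := fun v => if v ∈ C then φ v else g (Sum.inl v)
  refine IsSubdivisionSystem.containsSubdivision (b := b) (I := fun e => {(g (Sum.inr e) : W)})
    ⟨?_, ?_, ?_, ?_⟩
  · intro u v huv
    simp only [b] at huv
    split_ifs at huv with h1 h2 h2
    · exact hφ h1 h2 huv
    · exact absurd huv (hg _ u h1).ne
    · exact absurd huv (hg _ v h2).ne'
    · exact Sum.inl_injective (hinj _ _ huv)
  · intro e v hv
    simp only [b, Set.mem_singleton_iff] at hv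
    split_ifs at hv with h1
    · exact (hg _ v h1).ne hv
    · exact absurd (hinj _ _ hv) (by simp)
  · intro e e' hne
    rw [Set.disjoint_singleton]
    exact fun h => hne (Sum.inr_injective (hinj _ _ h))
  · intro u v huv
    by_cases h1 : u ∈ C
    · by_cases h2 : v ∈ C
      · have e1 : b u = φ u := if_pos h1
        have e2 : b v = φ v := if_pos h2
        have a1 : G.Adj (b u) (g (Sum.inr s(u, v))) := e1 ▸ hg _ u h1
        have a2 : G.Adj (g (Sum.inr s(u, v))) (b v) := e2 ▸ (hg _ v h2).symm
        refine ⟨.cons a1 (.cons a2 .nil), ?_⟩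
        simp only [SimpleGraph.Walk.support_cons, SimpleGraph.Walk.support_nil, List.mem_cons,
          List.not_mem_nil, or_false, Set.mem_singleton_iff]
        tauto
      · have a1 : G.Adj (b u) (b v) := by
          simp only [b, if_pos h1, if_neg h2]
          exact hg _ u h1
        refine ⟨.cons a1 .nil, ?_⟩
        simp
    · have h2 : v ∈ C := (hC u v huv).resolve_left h1
      have a1 : G.Adj (b u) (b v) := by
        simp only [b, if_neg h1, if_pos h2]
        exact (hg _ v h2).symm
      refine ⟨.cons a1 .nil, ?_⟩
      simp

/-- On a path, the vertices of a set all of whose neighbours lie in `L` are at most one more than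
the vertices of `L`. -/
theorem countP_support_le {W : Type*} {G : SimpleGraph W} (K L : W → Prop) [DecidablePred K]
    [DecidablePred L] (hKL : ∀ x, K x → ¬ L x) (hK : ∀ u v, G.Adj u v → K u → L v) {a b : W}
    (p : G.Walk a b) : p.support.countP (K ·) ≤ p.support.countP (L ·) + if K a then 1 else 0 := by
  -- Every `K`-vertex except possibly the first is immediately preceded by an `L`-vertex.
  induction p with
  | nil => simp only [SimpleGraph.Walk.support_nil, List.countP_singleton]; split_ifs <;> simp_all
  | @cons u v w h q ih =>
    rw [SimpleGraph.Walk.support_cons, List.countP_cons, List.countP_cons]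
    by_cases hu : K u
    · have hv := hK _ _ h hu
      have hv' : ¬ K v := fun h' => hKL _ h' hv
      simp only [hu, hv', hKL u hu, if_false, if_true, decide_true, decide_false] at ih ⊢
      simp at ih ⊢
      omega
    · by_cases hv : K v
      · have hu' := hK _ _ h.symm hv
        simp [hu, hv, hu'] at ih ⊢
        omega
      · simp [hu, hv] at ih ⊢
        omega

/-- Let `K` be a set of vertices whose neighbours in `G'` all lie in `L`, and suppose that the edges
of `G'` outside `K` and `L` are edges of `G`. If `G` has sufficiently many vertices in `K` that are
adjacent to all of `L`, then every graph with a subdivision in `G'` has one in `G`. -/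
theorem ContainsSubdivision.of_twins {V W : Type*} [Fintype V] [DecidableEq V] [DecidableEq W]
    {H : SimpleGraph V} {G G' : SimpleGraph W} (L K R : Finset W) (hRK : R ⊆ K)
    (hKL : Disjoint K L) (hR : ∀ r ∈ R, ∀ u ∈ L, G.Adj u r)
    (hK : ∀ u v, G'.Adj u v → u ∈ K → v ∈ L)
    (hG : ∀ u v, G'.Adj u v → u ∉ K → v ∉ K → G.Adj u v ∨ (u ∈ L ∧ v ∈ L))
    (hcard : Fintype.card V + Fintype.card (V × V) * (L.card + 1) +
      Fintype.card (Sym2 V) * (L.card * L.card) ≤ R.card)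
    (h : ContainsSubdivision H G') : ContainsSubdivision H G := by
  classical
  obtain ⟨M⟩ := h
  have hM := M.isSubdivisionSystem
  let P : V × V → Finset W := fun z =>
    if h : H.Adj z.1 z.2 then (M.path z.1 z.2 h).support.toFinset ∩ K else ∅
  have hP : ∀ z, (P z).card ≤ L.card + 1 := by
    intro z
    by_cases h : H.Adj z.1 z.2
    · have h1 := countP_support_le (· ∈ K) (· ∈ L) (fun x hx => Finset.disjoint_left.mp hKL hx) hK
        (M.path z.1 z.2 h)
      have hnd := (M.isPath z.1 z.2 h).support_nodup
      have e1 : (P z).card = (M.path z.1 z.2 h).support.countP (· ∈ K) := by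
        simp only [P, dif_pos h]
        rw [List.countP_eq_length_filter, ← List.toFinset_card_of_nodup (hnd.filter _)]
        congr 1
        ext x
        simp
      have e2 : (M.path z.1 z.2 h).support.countP (· ∈ L) ≤ L.card := by
        rw [List.countP_eq_length_filter, ← List.toFinset_card_of_nodup (hnd.filter _)]
        refine Finset.card_le_card fun x hx => ?_
        simp at hx
        exact hx.2
      rw [e1]
      split_ifs at h1 <;> omega
    · simp [P, dif_neg h]
  -- All vertices of `K` used by the model. Their number is bounded because a path meets `L` at most
  -- `L.card` times.
  let U : Finset W := (Finset.univ.image M.branch ∩ K) ∪ Finset.univ.biUnion P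
  have hUcard : U.card ≤ Fintype.card V + Fintype.card (V × V) * (L.card + 1) := by
    refine (Finset.card_union_le _ _).trans (Nat.add_le_add ?_ ?_)
    · exact (Finset.card_le_card Finset.inter_subset_left).trans Finset.card_image_le
    · exact Finset.card_biUnion_le_card_mul _ _ _ fun z _ => hP z
  have hUK : U ⊆ K := by
    intro x hx
    simp only [U, Finset.mem_union, Finset.mem_inter, Finset.mem_biUnion] at hx
    rcases hx with hx | ⟨z, -, hx⟩
    · exact hx.2
    · simp only [P] at hx
      split_ifs at hx
      · exact (Finset.mem_inter.mp hx).2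
      · simp at hx
  -- Targets in `R` for the used twins, plus a private midpoint for every edge of `H` and ordered
  -- pair in `L`.
  obtain ⟨g⟩ : Nonempty (U ⊕ Sym2 V × L × L ↪ R) := by
    refine Function.Embedding.nonempty_of_card_le ?_
    simp only [Fintype.card_sum, Fintype.card_coe, Fintype.card_prod] at hcard hUcard ⊢
    omega
  have hgR : ∀ z, (g z : W) ∈ R := fun z => (g z).2
  have hinj : ∀ z z', (g z : W) = g z' → z = z' := fun z z' h => g.injective (Subtype.ext h)
  let φ : W → W := fun x => if hx : x ∈ U then g (Sum.inl ⟨x, hx⟩) else x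
  -- The vertices the model may touch. A used vertex of `R` lies in `U` and is itself moved, so the
  -- targets never collide with fixed vertices.
  let A : Set W := {x | x ∉ K ∨ x ∈ U}
  have hφ : Set.InjOn φ A := by
    intro x hx y hy hxy
    simp only [φ] at hxy
    split_ifs at hxy with h1 h2 h2
    · simpa using hinj _ _ hxy
    · exact absurd (hRK (hxy ▸ hgR _)) (hy.resolve_right h2)
    · exact absurd (hRK (hxy ▸ hgR _)) (hx.resolve_right h1)
    · exact hxy
  have hφg : ∀ x ∈ A, ∀ z, φ x ≠ g (Sum.inr z) := by
    intro x hx z h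
    simp only [φ] at h
    split_ifs at h with h1
    · exact absurd (hinj _ _ h) (by simp)
    · exact hx.resolve_right h1 (hRK (h ▸ hgR _))
  have hbA : ∀ v, M.branch v ∈ A := by
    intro v
    by_cases hv : M.branch v ∈ K
    · exact Or.inr (Finset.mem_union_left _ (by simp [hv]))
    · exact Or.inl hv
  have hpA : ∀ u v h, ∀ x ∈ (M.path u v h).support, x ∈ A := by
    intro u v h x hx
    by_cases hv : x ∈ K
    · refine Or.inr (Finset.mem_union_right _ ?_)
      rw [Finset.mem_biUnion]
      refine ⟨(u, v), Finset.mem_univ _, ?_⟩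
      simp only [P, dif_pos h]
      simp [hx, hv]
    · exact Or.inl hv
  have hIA : ∀ e, M.interior e ⊆ A := by
    rintro e x ⟨-, u, v, h, -, hx⟩
    exact hpA u v h x hx
  let J : Sym2 V → Set W := fun e => {y | ∃ a c : L, y = g (Sum.inr (e, a, c))}
  have key : ∀ e : Sym2 V, ∀ a c, ∀ p : G'.Walk a c, (∀ x ∈ p.support, x ∈ A) →
      ∃ q : G.Walk (φ a) (φ c), ∀ y ∈ q.support, y ∈ φ '' {x | x ∈ p.support} ∪ J e := by
    intro e a c p
    induction p with
    | nil =>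
      intro _
      exact ⟨.nil, by simp⟩
    | @cons u v w h q ih =>
      intro hA
      obtain ⟨q', hq'⟩ := ih fun x hx => hA x (by simp [hx])
      have hstep : ∃ r : G.Walk (φ u) (φ v), ∀ y ∈ r.support, y = φ u ∨ y = φ v ∨ y ∈ J e := by
        have hU : ∀ x, x ∈ A → x ∈ K → φ x ∈ R := by
          intro x hx hxK
          simp only [φ, dif_pos (hx.resolve_left (not_not_intro hxK))]
          exact hgR _
        have hnK : ∀ x, x ∉ K → φ x = x := fun x hx => dif_neg fun h => hx (hUK h)
        have huA := hA u (by simp)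
        have hvA := hA v (by simp)
        have hsingle : G.Adj (φ u) (φ v) →
            ∃ r : G.Walk (φ u) (φ v), ∀ y ∈ r.support, y = φ u ∨ y = φ v ∨ y ∈ J e := by
          intro h'
          refine ⟨.cons h' .nil, fun y hy => ?_⟩
          simp at hy
          tauto
        by_cases hu : u ∈ K
        · have hv := hK _ _ h hu
          apply hsingle
          rw [hnK v fun hh => Finset.disjoint_left.mp hKL hh hv]
          exact (hR _ (hU u huA hu) _ hv).symm
        by_cases hv : v ∈ K
        · have hu' := hK _ _ h.symm hv
          apply hsingle
          rw [hnK u hu]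
          exact hR _ (hU v hvA hv) _ hu'
        rcases hG u v h hu hv with h1 | ⟨h1, h2⟩
        · apply hsingle
          rwa [hnK u hu, hnK v hv]
        -- An edge inside `L` may be absent from `G`; detour through its private common neighbour.
        · let t := g (Sum.inr (e, ⟨u, h1⟩, ⟨v, h2⟩))
          have a1 : G.Adj (φ u) t := by
            rw [hnK u hu]
            exact hR _ t.2 _ h1
          have a2 : G.Adj t (φ v) := by
            rw [hnK v hv]
            exact (hR _ t.2 _ h2).symm
          refine ⟨.cons a1 (.cons a2 .nil), fun y hy => ?_⟩
          simp only [SimpleGraph.Walk.support_cons, SimpleGraph.Walk.support_nil, List.mem_cons,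
            List.not_mem_nil, or_false] at hy
          rcases hy with rfl | rfl | rfl
          · exact Or.inl rfl
          · exact Or.inr (Or.inr ⟨_, _, rfl⟩)
          · exact Or.inr (Or.inl rfl)
      obtain ⟨r, hr⟩ := hstep
      refine ⟨r.append q', fun y hy => ?_⟩
      rw [SimpleGraph.Walk.mem_support_append_iff] at hy
      rcases hy with hy | hy
      · rcases hr y hy with rfl | rfl | hy
        · exact Or.inl ⟨u, by simp, rfl⟩
        · exact Or.inl ⟨v, by simp, rfl⟩
        · exact Or.inr hy
      · rcases hq' y hy with ⟨x, hx, rfl⟩ | hy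
        · refine Or.inl ⟨x, ?_, rfl⟩
          simp only [Set.mem_ofPred_eq] at hx ⊢
          simp [hx]
        · exact Or.inr hy
  refine IsSubdivisionSystem.containsSubdivision (b := fun v => φ (M.branch v))
    (I := fun e => φ '' M.interior e ∪ J e) ⟨?_, ?_, ?_, ?_⟩
  · intro u v huv
    exact hM.injective (hφ (hbA u) (hbA v) huv)
  · rintro e v (⟨x, hx, hxv⟩ | ⟨a, c, h⟩)
    · have := hφ (hIA e hx) (hbA v) hxv
      exact hM.branch_notMem e v (this ▸ hx)
    · exact hφg _ (hbA v) _ h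
  · intro e e' hne
    rw [Set.disjoint_left]
    rintro y (⟨x, hx, rfl⟩ | ⟨a, c, rfl⟩) (⟨x', hx', h⟩ | ⟨a', c', h⟩)
    · have := hφ (hIA e' hx') (hIA e hx) h
      exact Set.disjoint_left.mp (hM.disjoint e e' hne) hx (this ▸ hx')
    · exact hφg _ (hIA e hx) _ h
    · exact hφg _ (hIA e' hx') _ h
    · have := hinj _ _ h
      simp at this
      exact hne this.1
  · intro u v huv
    obtain ⟨q, hq⟩ := key s(u, v) _ _ (M.path u v huv) (hpA u v huv)
    refine ⟨q, fun y hy => ?_⟩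
    rcases hq y hy with ⟨x, hx, rfl⟩ | hy
    · by_cases hb : x ∈ Set.range M.branch
      · obtain ⟨w, rfl⟩ := hb
        rcases M.branch_mem u v huv w hx with rfl | rfl
        · exact Or.inl rfl
        · exact Or.inr (Or.inl rfl)
      · exact Or.inr (Or.inr (Or.inl ⟨x, ⟨hb, u, v, huv, rfl, hx⟩, rfl⟩))
    · exact Or.inr (Or.inr (Or.inr hy))

/-! ### Mader's theorem -/

open Classical in
/-- The neighbours of `v` in `S`. -/
noncomputable def nbrsIn {W : Type*} (G : SimpleGraph W) (S : Finset W) (v : W) : Finset W :=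
  {w ∈ S | G.Adj v w}

@[simp]
theorem mem_nbrsIn {W : Type*} {G : SimpleGraph W} {S : Finset W} {v w : W} :
    w ∈ nbrsIn G S v ↔ w ∈ S ∧ G.Adj v w := by
  simp [nbrsIn]

/-- The number of ordered pairs of adjacent vertices in `S`. -/
noncomputable def adjCount {W : Type*} (G : SimpleGraph W) (S : Finset W) : ℕ :=
  ∑ v ∈ S, (nbrsIn G S v).card

theorem adjCount_eq_erase {W : Type*} [DecidableEq W] (G : SimpleGraph W) {S : Finset W} {v : W}
    (hv : v ∈ S) : adjCount G S = adjCount G (S.erase v) + 2 * (nbrsIn G S v).card := by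
  classical
  have h1 : ∀ u ∈ S.erase v, (nbrsIn G S u).card =
      (nbrsIn G (S.erase v) u).card + if G.Adj v u then 1 else 0 := by
    intro u hu
    split_ifs with h
    · have : nbrsIn G (S.erase v) u = (nbrsIn G S u).erase v := by
        ext; simp; tauto
      rw [this, Finset.card_erase_add_one]
      simp [hv, h.symm]
    · have : nbrsIn G (S.erase v) u = nbrsIn G S u := by
        ext w
        simp only [mem_nbrsIn, Finset.mem_erase]
        refine ⟨fun hw => ⟨hw.1.2, hw.2⟩, fun hw => ⟨⟨?_, hw.1⟩, hw.2⟩⟩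
        rintro rfl
        exact h hw.2.symm
      rw [this, add_zero]
  have h2 : (nbrsIn G S v).card = ∑ u ∈ S.erase v, if G.Adj v u then 1 else 0 := by
    rw [← Finset.sum_filter, Finset.sum_const, smul_eq_mul, mul_one]
    congr 1
    ext u
    simp only [mem_nbrsIn, Finset.mem_filter, Finset.mem_erase]
    exact ⟨fun h => ⟨⟨h.2.ne', h.1⟩, h.2⟩, fun h => ⟨h.1.2, h.2⟩⟩
  rw [adjCount, ← Finset.sum_erase_add _ _ hv, Finset.sum_congr rfl h1, Finset.sum_add_distrib,
    ← h2, adjCount]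
  ring

/-- A sufficiently dense nonempty vertex set contains either a connected set `U` with a nonempty
set `N` of neighbours that is itself dense, or a smaller dense set. -/
theorem exists_dense_neighborhood {W : Type*} [DecidableEq W] (G : SimpleGraph W) (c : ℕ)
    (S : Finset W) (hS : S.Nonempty) (hd : (2 * c + 2) * S.card ≤ adjCount G S) :
    (∃ T ⊂ S, T.Nonempty ∧ (2 * c + 2) * T.card ≤ adjCount G T) ∨
    ∃ U N : Finset W, U ⊆ S ∧ N ⊆ S ∧ Disjoint U N ∧ N.Nonempty ∧ c * N.card ≤ adjCount G N ∧
      (∀ v ∈ N, ∃ a ∈ U, G.Adj a v) ∧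
      ∀ a ∈ U, ∀ b ∈ U, ∃ p : G.Walk a b, ∀ z ∈ p.support, z ∈ U := by
  classical
  let N : Finset W → Finset W := fun U => {v ∈ S \ U | ∃ a ∈ U, G.Adj a v}
  -- Contract a connected `U` to one vertex: the result has `(S \ U).card + 1` vertices and `N U` is
  -- the neighbourhood of the new vertex. `good` says that its density is still at least `2 * c + 2`
  -- in ordered pairs. Take `U` maximal.
  let good : Finset W → Prop := fun U =>
    (∃ r ∈ U, ∀ a ∈ U, ∃ p : G.Walk r a, ∀ z ∈ p.support, z ∈ U) ∧
      (2 * c + 2) * ((S \ U).card + 1) ≤ adjCount G (S \ U) + 2 * (N U).card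
  obtain ⟨u, hu⟩ := hS
  have hgood : good {u} := by
    refine ⟨⟨u, by simp, fun a ha => ?_⟩, ?_⟩
    · obtain rfl : a = u := by simpa using ha
      exact ⟨.nil, by simp⟩
    · have e1 : S \ {u} = S.erase u := by simp [Finset.sdiff_singleton_eq_erase]
      have e2 : N {u} = nbrsIn G S u := by
        ext v
        simp only [N, Finset.mem_filter, mem_nbrsIn, Finset.mem_sdiff, Finset.mem_singleton,
          exists_eq_left]
        exact ⟨fun h => ⟨h.1.1, h.2⟩, fun h => ⟨⟨h.1, h.2.ne'⟩, h.2⟩⟩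
      rw [e1, e2, ← adjCount_eq_erase G hu, Finset.card_erase_add_one hu]
      exact hd
  obtain ⟨U, hU, hmax⟩ := Finset.exists_max_image (S.powerset.filter good) Finset.card
    ⟨{u}, by simp [hu, hgood]⟩
  rw [Finset.mem_filter, Finset.mem_powerset] at hU
  obtain ⟨hUS, ⟨r, hrU, hr⟩, hUd⟩ := hU
  rcases (N U).eq_empty_or_nonempty with hN | hN
  · left
    refine ⟨S \ U, Finset.sdiff_ssubset hUS ⟨r, hrU⟩, ?_, ?_⟩
    · rw [Finset.nonempty_iff_ne_empty]
      intro h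
      simp [h, hN, adjCount] at hUd
    · rw [hN] at hUd
      simp only [Finset.card_empty] at hUd
      nlinarith
  right
  refine ⟨U, N U, hUS, (Finset.filter_subset _ _).trans Finset.sdiff_subset, ?_, hN, ?_, ?_, ?_⟩
  · exact Finset.disjoint_sdiff.mono_right (Finset.filter_subset _ _)
  · rw [mul_comm, adjCount, ← smul_eq_mul]
    refine Finset.card_nsmul_le_sum _ _ _ fun v hv => ?_
    -- Absorbing `v` into `U` loses one vertex, the edge from the contracted vertex to `v`, and one
    -- edge per neighbour of `v` in `N U`. With fewer than `c` such neighbours the density would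
    -- survive, against maximality.
    by_contra! hlt
    have hv' : v ∈ S \ U ∧ ∃ a ∈ U, G.Adj a v := by simpa [N] using hv
    obtain ⟨hvSU, a, haU, hav⟩ := hv'
    have hvS := (Finset.mem_sdiff.mp hvSU).1
    have hvU := (Finset.mem_sdiff.mp hvSU).2
    have e1 : S \ insert v U = (S \ U).erase v := by
      ext; simp; tauto
    have h1 := adjCount_eq_erase G hvSU
    have h2 : ((N U).erase v) ∪ (nbrsIn G (S \ U) v \ N U) ⊆ N (insert v U) := by
      intro w hw
      simp only [N, Finset.mem_union, Finset.mem_erase, Finset.mem_sdiff, mem_nbrsIn,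
        Finset.mem_filter, Finset.mem_insert] at hw ⊢
      rcases hw with ⟨h1, h2, a, h3⟩ | ⟨⟨h1, h2⟩, h3⟩
      · exact ⟨⟨h2.1, by tauto⟩, a, Or.inr h3.1, h3.2⟩
      · refine ⟨⟨h1.1, ?_⟩, v, Or.inl rfl, h2⟩
        have := h2.ne'
        tauto
    have h3 := Finset.card_le_card h2
    rw [Finset.card_union_of_disjoint (Finset.disjoint_of_subset_left (Finset.erase_subset _ _)
      Finset.disjoint_sdiff)] at h3
    have h4 := Finset.card_erase_add_one hv
    have h5 : (nbrsIn G (S \ U) v).card ≤ (nbrsIn G (S \ U) v \ N U).card +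
        (nbrsIn G (N U) v).card := by
      rw [← Finset.card_sdiff_add_card_inter _ (N U)]
      refine Nat.add_le_add_left (Finset.card_le_card fun w hw => ?_) _
      simp only [Finset.mem_inter, mem_nbrsIn] at hw ⊢
      exact ⟨hw.2, hw.1.2⟩
    have h6 := Finset.card_erase_add_one hvSU
    have hgood' : good (insert v U) := by
      refine ⟨⟨r, by simp [hrU], fun b hb => ?_⟩, ?_⟩
      · rcases Finset.mem_insert.mp hb with rfl | hb
        · obtain ⟨p, hp⟩ := hr a haU
          refine ⟨p.concat hav, fun z hz => ?_⟩
          rw [SimpleGraph.Walk.support_concat] at hz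
          rw [List.mem_append, List.mem_singleton] at hz
          rcases hz with hz | rfl
          · exact Finset.mem_insert_of_mem (hp z hz)
          · exact Finset.mem_insert_self _ _
        · obtain ⟨p, hp⟩ := hr b hb
          exact ⟨p, fun z hz => Finset.mem_insert_of_mem (hp z hz)⟩
      · rw [e1, h6]
        rw [← h6] at hUd
        have : (2 * c + 2) * (((S \ U).erase v).card + 1 + 1) =
          (2 * c + 2) * (((S \ U).erase v).card + 1) + (2 * c + 2) := by ring
        rw [← h6]
        omega
    have := hmax (insert v U) (by
      rw [Finset.mem_filter, Finset.mem_powerset]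
      exact ⟨Finset.insert_subset hvS hUS, hgood'⟩)
    rw [Finset.card_insert_of_notMem hvU] at this
    omega
  · intro v hv
    exact (Finset.mem_filter.mp hv).2
  · intro a ha b hb
    obtain ⟨p, hp⟩ := hr a ha
    obtain ⟨q, hq⟩ := hr b hb
    refine ⟨p.reverse.append q, fun z hz => ?_⟩
    rw [SimpleGraph.Walk.mem_support_append_iff, SimpleGraph.Walk.support_reverse,
      List.mem_reverse] at hz
    exact hz.elim (hp z) (hq z)

/-- **Mader's theorem**: dense vertex sets contain subdivisions. -/
theorem exists_isSubdivisionSystem_of_dense (V : Type*) [Fintype V] (m : ℕ) :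
    ∃ c : ℕ, ∀ X : SimpleGraph V, X.edgeSet.ncard = m → ∀ {W : Type*} [DecidableEq W]
      (G : SimpleGraph W) (S : Finset W), S.Nonempty → c * S.card ≤ adjCount G S →
      ∃ (b : V → W) (I : Sym2 V → Set W), IsSubdivisionSystem X G b I ∧ (∀ v, b v ∈ S) ∧
        ∀ e, I e ⊆ S := by
  classical
  induction m with
  | zero =>
    -- Without edges only `S.card ≥ Fintype.card V` is needed, which follows from the trivial bound
    -- `S.card ^ 2` on adjacent pairs.
    refine ⟨Fintype.card V, fun X hX W _ G S hS hd => ?_⟩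
    have h1 : adjCount G S ≤ S.card * S.card := by
      rw [adjCount, ← smul_eq_mul]
      exact Finset.sum_le_card_nsmul _ _ _ fun v _ =>
        Finset.card_le_card fun w hw => (mem_nbrsIn.mp hw).1
    have h2 : Fintype.card V ≤ Fintype.card S := by
      rw [Fintype.card_coe]
      exact Nat.le_of_mul_le_mul_right (hd.trans h1) hS.card_pos
    obtain ⟨g⟩ := Function.Embedding.nonempty_of_card_le h2
    refine ⟨fun v => g v, fun _ => ∅, ⟨?_, by simp, by simp, ?_⟩, fun v => (g v).2, by simp⟩
    · exact Subtype.val_injective.comp g.injective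
    · intro u v huv
      rw [Set.ncard_eq_zero] at hX
      exact absurd (show s(u, v) ∈ X.edgeSet from huv) (by simp [hX])
  | succ m ih =>
    obtain ⟨c, hc⟩ := ih
    refine ⟨2 * c + 2, fun X hX W _ G S => ?_⟩
    induction S using Finset.strongInduction with | _ S ihS => ?_
    intro hS hd
    rcases exists_dense_neighborhood G c S hS hd with ⟨T, hT, hTne, hTd⟩ |
      ⟨U, N, hUS, hNS, hUN, hNne, hNd, hadj, hconn⟩
    · obtain ⟨b, I, h1, h2, h3⟩ := ihS T hT hTne hTd
      exact ⟨b, I, h1, fun v => hT.subset (h2 v), fun e => (h3 e).trans 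
        (by exact_mod_cast hT.subset)⟩
    · obtain ⟨e0, he0⟩ : X.edgeSet.Nonempty := by
        rw [Set.nonempty_iff_ne_empty]
        rintro h
        simp [h] at hX
      have hY : (X.deleteEdges {e0}).edgeSet.ncard = m := by
        rw [SimpleGraph.edgeSet_deleteEdges, Set.ncard_sdiff_singleton_of_mem he0, hX]
        rfl
      obtain ⟨b, I, h1, h2, h3⟩ := hc _ hY G N hNne hNd
      have hUN' : ∀ x ∈ N, x ∉ U := fun x hx hx' => Finset.disjoint_left.mp hUN hx' hx
      -- `X` without `e0` is found inside `N`; the missing edge is routed through the connected set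
      -- `U`, which is disjoint from `N` and adjacent to each of its vertices.
      refine ⟨b, Function.update I e0 U, ⟨h1.injective, ?_, ?_, ?_⟩, fun v => hNS (h2 v), ?_⟩
      · intro e v
        by_cases he : e = e0
        · subst he
          simpa using hUN' _ (h2 v)
        · rw [Function.update_of_ne he]
          exact h1.branch_notMem e v
      · intro e e' hne
        have hU : ∀ e, Disjoint (U : Set W) (I e) := fun e =>
          Set.disjoint_left.mpr fun x hx hx' => hUN' x (h3 e hx') hx
        by_cases he : e = e0
        · subst he
          rw [Function.update_self, Function.update_of_ne hne.symm]
          exact hU _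
        · rw [Function.update_of_ne he]
          by_cases he' : e' = e0
          · subst he'
            rw [Function.update_self]
            exact (hU _).symm
          · rw [Function.update_of_ne he']
            exact h1.disjoint e e' hne
      · intro u v huv
        by_cases he : s(u, v) = e0
        · obtain ⟨a, ha, hau⟩ := hadj _ (h2 u)
          obtain ⟨a', ha', hav⟩ := hadj _ (h2 v)
          obtain ⟨p, hp⟩ := hconn a ha a' ha'
          refine ⟨.cons hau.symm (p.concat hav), fun x hx => ?_⟩
          rw [he, Function.update_self]
          simp only [SimpleGraph.Walk.support_cons, SimpleGraph.Walk.support_concat, List.mem_cons,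
            List.mem_append, List.not_mem_nil, or_false] at hx
          rcases hx with hx | hx | hx
          · exact Or.inl hx
          · exact Or.inr (Or.inr (hp x hx))
          · exact Or.inr (Or.inl hx)
        · rw [Function.update_of_ne he]
          exact h1.exists_walk u v (by simp [huv, he])
      · intro e
        by_cases he : e = e0
        · subst he
          simpa using hUS
        · rw [Function.update_of_ne he]
          exact (h3 e).trans (by exact_mod_cast hNS)

/-- **Mader's theorem**: a graph without a subdivision of `H` has linearly many edges. -/
theorem exists_adjCount_le_of_not_containsSubdivision {V : Type*} [Fintype V]
    (H : SimpleGraph V) : ∃ D : ℕ, ∀ {W : Type*} [DecidableEq W] (G : SimpleGraph W),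
      ¬ ContainsSubdivision H G → ∀ S : Finset W, adjCount G S ≤ D * S.card := by
  obtain ⟨c, hc⟩ := exists_isSubdivisionSystem_of_dense V H.edgeSet.ncard
  refine ⟨c, fun {W} _ G hG S => ?_⟩
  by_contra! h
  rcases S.eq_empty_or_nonempty with rfl | hS
  · simp [adjCount] at h
  obtain ⟨b, I, h1, -⟩ := hc H rfl G S hS h.le
  exact hG h1.containsSubdivision

/-! ### Spectral radius, Rayleigh quotient and a nonnegative eigenvector -/

open Classical in
theorem adjMatrix_mulVec_eq_sum_nbrsIn {W : Type*} [Fintype W] (G : SimpleGraph W) (y : W → ℝ)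
    (u : W) : (G.adjMatrix ℝ).mulVec y u = ∑ v ∈ nbrsIn G Finset.univ u, y v := by
  rw [SimpleGraph.adjMatrix_mulVec_apply]
  refine Finset.sum_congr ?_ fun _ _ => rfl
  ext v
  simp

open Classical in
theorem dotProduct_adjMatrix_mulVec {W : Type*} [Fintype W] (G : SimpleGraph W) (y : W → ℝ) :
    y ⬝ᵥ (G.adjMatrix ℝ).mulVec y = ∑ u, ∑ v ∈ nbrsIn G Finset.univ u, y u * y v := by
  simp only [dotProduct, adjMatrix_mulVec_eq_sum_nbrsIn, Finset.mul_sum]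

open Classical in
theorem exists_mem_spectrum_rho_eq {W : Type*} [Fintype W] [Nonempty W] (G : SimpleGraph W) :
    ∃ μ ∈ spectrum ℝ (G.adjMatrix ℝ), rho G = ‖μ‖₊ ∧
      ∀ k ∈ spectrum ℝ (G.adjMatrix ℝ), |k| ≤ |μ| := by
  have hA : (G.adjMatrix ℝ).IsHermitian := by
    rw [Matrix.IsHermitian, Matrix.conjTranspose_eq_transpose_of_trivial]
    exact G.isSymm_adjMatrix
  have hne : (spectrum ℝ (G.adjMatrix ℝ)).Nonempty := by
    rw [hA.spectrum_real_eq_range_eigenvalues]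
    exact Set.range_nonempty _
  obtain ⟨μ, hμ, hmax⟩ := Set.exists_max_image _ (fun k : ℝ => ‖k‖₊)
    (Matrix.finite_real_spectrum (A := G.adjMatrix ℝ)) hne
  refine ⟨μ, hμ, ?_, fun k hk => by simpa [← NNReal.coe_le_coe] using hmax k hk⟩
  refine le_antisymm (iSup₂_le fun k hk => ?_) (le_iSup₂_of_le μ hμ le_rfl)
  exact_mod_cast hmax k hk

theorem rho_ne_top {W : Type*} [Fintype W] [Nonempty W] (G : SimpleGraph W) : rho G ≠ ⊤ := by
  obtain ⟨μ, -, h, -⟩ := exists_mem_spectrum_rho_eq G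
  simp [h]

open Classical in
theorem posSemidef_rho_sub_adjMatrix {W : Type*} [Fintype W] [Nonempty W] (G : SimpleGraph W) :
    ((algebraMap ℝ (Matrix W W ℝ)) (rho G).toReal - G.adjMatrix ℝ).PosSemidef := by
  obtain ⟨μ, hμ, h, hmax⟩ := exists_mem_spectrum_rho_eq G
  have hr : (rho G).toReal = |μ| := by simp [h]
  rw [Matrix.posSemidef_iff_isHermitian_and_spectrum_nonneg]
  refine ⟨?_, ?_⟩
  · refine Matrix.IsHermitian.sub ?_ ?_
    · rw [Matrix.algebraMap_eq_diagonal]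
      exact Matrix.isHermitian_diagonal _
    · rw [Matrix.IsHermitian, Matrix.conjTranspose_eq_transpose_of_trivial]
      exact G.isSymm_adjMatrix
  · rw [← spectrum.singleton_sub_eq]
    rintro _ ⟨a, rfl, k, hk, rfl⟩
    have := hmax k hk
    have := le_abs_self k
    simp only [Set.mem_ofPred_eq, hr]
    linarith

/-- The Rayleigh quotient of the adjacency matrix is at most the spectral radius. -/
theorem sum_mul_le_rho_mul_sum_sq {W : Type*} [Fintype W] [Nonempty W] (G : SimpleGraph W)
    (y : W → ℝ) :
    ∑ u, ∑ v ∈ nbrsIn G Finset.univ u, y u * y v ≤ (rho G).toReal * ∑ u, y u ^ 2 := by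
  classical
  have h := (Matrix.posSemidef_iff_dotProduct_mulVec.mp (posSemidef_rho_sub_adjMatrix G)).2 y
  rw [star_trivial, Matrix.sub_mulVec, dotProduct_sub, dotProduct_adjMatrix_mulVec,
    Algebra.algebraMap_eq_smul_one, Matrix.smul_mulVec, Matrix.one_mulVec, dotProduct_smul] at h
  have e : y ⬝ᵥ y = ∑ u, y u ^ 2 := by simp [dotProduct, sq]
  rw [e, smul_eq_mul] at h
  linarith

/-- The spectral radius has a nonnegative eigenvector with largest entry `1`. -/
theorem exists_nonneg_eigenvector {W : Type*} [Fintype W] [Nonempty W] (G : SimpleGraph W) :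
    ∃ x : W → ℝ, (∀ u, 0 ≤ x u) ∧ (∀ u, x u ≤ 1) ∧ (∃ u, x u = 1) ∧
      ∀ u, ∑ v ∈ nbrsIn G Finset.univ u, x v = (rho G).toReal * x u := by
  classical
  obtain ⟨μ, hμ, h, -⟩ := exists_mem_spectrum_rho_eq G
  have hr : (rho G).toReal = |μ| := by simp [h]
  rw [← Matrix.spectrum_toLin', ← Module.End.hasEigenvalue_iff_mem_spectrum] at hμ
  obtain ⟨z, hz⟩ := hμ.exists_hasEigenvector
  have hz1 : (G.adjMatrix ℝ).mulVec z = μ • z := by simpa using hz.apply_eq_smul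
  have hz0 : z ≠ 0 := hz.2
  -- Taking absolute values cannot lower the modulus of the quadratic form, so `y` attains the
  -- Rayleigh bound. A zero of a positive semidefinite form lies in the kernel, hence `y` is an
  -- eigenvector even if `G` is disconnected.
  let y : W → ℝ := fun u => |z u|
  have hsq : ∑ u, y u ^ 2 = ∑ u, z u ^ 2 := by simp [y]
  have h1 : (rho G).toReal * ∑ u, y u ^ 2 ≤ ∑ u, ∑ v ∈ nbrsIn G Finset.univ u, y u * y v := by
    have e : μ * ∑ u, z u ^ 2 = ∑ u, ∑ v ∈ nbrsIn G Finset.univ u, z u * z v := by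
      rw [← dotProduct_adjMatrix_mulVec, hz1, dotProduct_smul, smul_eq_mul]
      simp [dotProduct, sq]
    calc (rho G).toReal * ∑ u, y u ^ 2 = |μ * ∑ u, z u ^ 2| := by
          rw [abs_mul, hr, hsq, abs_of_nonneg (a := ∑ u, z u ^ 2)]
          positivity
      _ ≤ ∑ u, ∑ v ∈ nbrsIn G Finset.univ u, y u * y v := by
          rw [e]
          refine (Finset.abs_sum_le_sum_abs _ _).trans (Finset.sum_le_sum fun u _ => ?_)
          refine (Finset.abs_sum_le_sum_abs _ _).trans (Finset.sum_le_sum fun v _ => ?_)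
          rw [abs_mul]
  have hps := posSemidef_rho_sub_adjMatrix G
  have h2 : star y ⬝ᵥ ((algebraMap ℝ (Matrix W W ℝ)) (rho G).toReal - G.adjMatrix ℝ).mulVec y
      = 0 := by
    refine le_antisymm ?_ ((Matrix.posSemidef_iff_dotProduct_mulVec.mp hps).2 y)
    rw [star_trivial, Matrix.sub_mulVec, dotProduct_sub, dotProduct_adjMatrix_mulVec,
      Algebra.algebraMap_eq_smul_one, Matrix.smul_mulVec, Matrix.one_mulVec, dotProduct_smul]
    have e : y ⬝ᵥ y = ∑ u, y u ^ 2 := by simp [dotProduct, sq]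
    rw [e, smul_eq_mul]
    linarith
  rw [hps.dotProduct_mulVec_zero_iff] at h2
  have h3 : ∀ u, ∑ v ∈ nbrsIn G Finset.univ u, y v = (rho G).toReal * y u := by
    intro u
    have := congrFun h2 u
    rw [Matrix.sub_mulVec, Algebra.algebraMap_eq_smul_one, Matrix.smul_mulVec,
      Matrix.one_mulVec] at this
    simp only [Pi.sub_apply, Pi.smul_apply, adjMatrix_mulVec_eq_sum_nbrsIn, Pi.zero_apply,
      smul_eq_mul] at this
    linarith
  obtain ⟨u0, hu0⟩ := Finite.exists_max y
  have hpos : 0 < y u0 := by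
    obtain ⟨w, hw⟩ := Function.ne_iff.mp hz0
    exact (abs_pos.mpr hw).trans_le (hu0 w)
  refine ⟨fun u => y u / y u0, fun u => div_nonneg (abs_nonneg _) hpos.le,
    fun u => (div_le_one hpos).mpr (hu0 u), ⟨u0, div_self hpos.ne'⟩, fun u => ?_⟩
  rw [← Finset.sum_div, h3, mul_div_assoc]

/-! ### Large entries and hubs -/

/-- An eigenpair `(lam, x)` of a graph `G`, with `x` nonnegative and of maximum `1`, where `G` has
linearly many edges on every vertex set, no `γ + 1` vertices with `T` common neighbours, and
`lam` is at least as large as for a generalized book. -/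
structure IsSparseEigenpair {W : Type*} [Fintype W] (G : SimpleGraph W) (γ D T : ℕ)
    (lam : ℝ) (x : W → ℝ) : Prop where
  nonneg : ∀ u, 0 ≤ x u
  le_one : ∀ u, x u ≤ 1
  exists_one : ∃ u, x u = 1
  eigen : ∀ u, ∑ v ∈ nbrsIn G Finset.univ u, x v = lam * x u
  sparse : ∀ S : Finset W, adjCount G S ≤ D * S.card
  common : ∀ L S : Finset W, L.card = γ + 1 → (∀ s ∈ S, ∀ l ∈ L, G.Adj l s) → S.card < T
  lam_nonneg : 0 ≤ lam
  lam_sq : (γ : ℝ) * (Fintype.card W - γ) ≤ lam ^ 2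
  one_le_gamma : 1 ≤ γ
  one_le_density : 1 ≤ D
  two_mul_le_card : 2 * γ ≤ Fintype.card W

/-- The vertices with entry at least `t`. -/
noncomputable def largeEntries {W : Type*} [Fintype W] (x : W → ℝ) (t : ℝ) : Finset W :=
  {v | t ≤ x v}

@[simp]
theorem mem_largeEntries {W : Type*} [Fintype W] {x : W → ℝ} {t : ℝ} {v : W} :
    v ∈ largeEntries x t ↔ t ≤ x v := by
  simp [largeEntries]

theorem sum_card_nbrsIn_le_adjCount {W : Type*} {G : SimpleGraph W} {S A B : Finset W}
    (hA : A ⊆ S) (hB : B ⊆ S) : ∑ v ∈ A, (nbrsIn G B v).card ≤ adjCount G S := by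
  refine (Finset.sum_le_sum fun v _ => Finset.card_le_card fun w hw => ?_).trans
    (Finset.sum_le_sum_of_subset hA)
  simp only [mem_nbrsIn] at hw ⊢
  exact ⟨hB hw.1, hw.2⟩

namespace IsSparseEigenpair

variable {W : Type*} [Fintype W] {G : SimpleGraph W} {γ D T : ℕ} {lam : ℝ} {x : W → ℝ}

theorem card_pos (h : IsSparseEigenpair G γ D T lam x) : (0 : ℝ) < Fintype.card W := by
  have := h.two_mul_le_card
  have := h.one_le_gamma
  exact_mod_cast (by omega : 0 < Fintype.card W)

theorem card_div_two_le (h : IsSparseEigenpair G γ D T lam x) :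
    (Fintype.card W : ℝ) / 2 ≤ lam ^ 2 := by
  have h1 : (1 : ℝ) ≤ γ := by exact_mod_cast h.one_le_gamma
  have h2 : (2 : ℝ) * γ ≤ Fintype.card W := by exact_mod_cast h.two_mul_le_card
  nlinarith [h.lam_sq]

theorem lam_pos (h : IsSparseEigenpair G γ D T lam x) : 0 < lam := by
  refine lt_of_le_of_ne h.lam_nonneg fun h0 => ?_
  have h1 := h.card_div_two_le
  have h2 := h.card_pos
  rw [← h0] at h1
  norm_num at h1
  linarith

theorem sum_degrees_le (h : IsSparseEigenpair G γ D T lam x) (A : Finset W) :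
    ∑ v ∈ A, ((nbrsIn G Finset.univ v).card : ℝ) ≤ D * Fintype.card W := by
  have := (sum_card_nbrsIn_le_adjCount (G := G) (Finset.subset_univ A)
    (Finset.Subset.refl Finset.univ)).trans (h.sparse Finset.univ)
  rw [Finset.card_univ] at this
  exact_mod_cast this

/-- Apply the eigenvalue equation twice; 2-walks ending at an entry below `t` contribute at most `t`
times the sum of all degrees. -/
theorem lam_sq_mul_le (h : IsSparseEigenpair G γ D T lam x) {t : ℝ} (ht : 0 ≤ t) (u : W) :
    lam ^ 2 * x u ≤ ∑ v ∈ nbrsIn G Finset.univ u, ∑ w ∈ nbrsIn G (largeEntries x t) v, x w +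
      t * (D * Fintype.card W) := by
  classical
  have h1 : lam ^ 2 * x u =
      ∑ v ∈ nbrsIn G Finset.univ u, ∑ w ∈ nbrsIn G Finset.univ v, x w := by
    rw [sq, mul_assoc, ← h.eigen u, Finset.mul_sum]
    exact Finset.sum_congr rfl fun v _ => (h.eigen v).symm
  have h2 : ∀ v, ∑ w ∈ nbrsIn G Finset.univ v, x w ≤
      ∑ w ∈ nbrsIn G (largeEntries x t) v, x w + t * (nbrsIn G Finset.univ v).card := by
    intro v
    have hsub : nbrsIn G (largeEntries x t) v ⊆ nbrsIn G Finset.univ v := by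
      intro w; simp
    rw [← Finset.sum_sdiff hsub, add_comm]
    gcongr
    calc ∑ w ∈ nbrsIn G Finset.univ v \ nbrsIn G (largeEntries x t) v, x w
        ≤ ∑ w ∈ nbrsIn G Finset.univ v \ nbrsIn G (largeEntries x t) v, t := by
          refine Finset.sum_le_sum fun w hw => ?_
          simp at hw
          exact le_of_lt (not_le.mp fun h' => hw.2 h' hw.1)
      _ ≤ ∑ w ∈ nbrsIn G Finset.univ v, t :=
          Finset.sum_le_sum_of_subset_of_nonneg Finset.sdiff_subset fun _ _ _ => ht
      _ = t * (nbrsIn G Finset.univ v).card := by simp [mul_comm]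
  rw [h1]
  refine (Finset.sum_le_sum fun v _ => h2 v).trans ?_
  rw [Finset.sum_add_distrib, ← Finset.mul_sum]
  gcongr
  exact h.sum_degrees_le _

/-- An entry at least `t` forces degree at least `lam * t`. This crude bound of order √n starts the
bootstrap to a bounded number. -/
theorem lam_mul_card_largeEntries_le (h : IsSparseEigenpair G γ D T lam x) (t : ℝ) :
    lam * t * (largeEntries x t).card ≤ D * Fintype.card W := by
  calc lam * t * (largeEntries x t).card = ∑ v ∈ largeEntries x t, lam * t := by
        simp [mul_comm]
    _ ≤ ∑ v ∈ largeEntries x t, ((nbrsIn G Finset.univ v).card : ℝ) := by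
        refine Finset.sum_le_sum fun v hv => ?_
        have h1 : lam * t ≤ lam * x v :=
          mul_le_mul_of_nonneg_left (mem_largeEntries.mp hv) h.lam_nonneg
        rw [← h.eigen v] at h1
        refine h1.trans ((Finset.sum_le_sum fun w _ => h.le_one w).trans ?_)
        simp
    _ ≤ D * Fintype.card W := h.sum_degrees_le _

theorem degree_ge_of_le (h : IsSparseEigenpair G γ D T lam x) {t : ℝ} (ht : 0 < t)
    (hlam : 64 * (D : ℝ) ^ 3 ≤ lam * t ^ 2) {u : W} (hu : t ≤ x u) :
    t * Fintype.card W ≤ 4 * D * (nbrsIn G Finset.univ u).card := by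
  classical
  have hD : (1 : ℝ) ≤ D := by exact_mod_cast h.one_le_density
  have hn := h.card_pos
  have hl := h.lam_pos
  set n : ℝ := (Fintype.card W : ℝ)
  -- With this lower threshold the small entries cost only `t * n / 8`. The large ones are
  -- controlled by the edges between the neighbourhood of `u` and `largeEntries x s`, by sparsity on
  -- the union.
  let s : ℝ := t / (8 * D)
  have hs : 0 < s := by positivity
  have h1 := h.lam_sq_mul_le hs.le u
  have h2 : ∑ v ∈ nbrsIn G Finset.univ u, ∑ w ∈ nbrsIn G (largeEntries x s) v, x w ≤
      D * ((nbrsIn G Finset.univ u).card + (largeEntries x s).card) := by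
    calc _ ≤ ∑ v ∈ nbrsIn G Finset.univ u, ((nbrsIn G (largeEntries x s) v).card : ℝ) := by
          refine Finset.sum_le_sum fun v _ => ?_
          refine (Finset.sum_le_sum fun w _ => h.le_one w).trans ?_
          simp
      _ ≤ _ := by
          have := (sum_card_nbrsIn_le_adjCount (G := G) (A := nbrsIn G Finset.univ u)
            (B := largeEntries x s) Finset.subset_union_left Finset.subset_union_right).trans
            ((h.sparse _).trans (Nat.mul_le_mul_left D (Finset.card_union_le _ _)))
          exact_mod_cast this
  have h3 := h.lam_mul_card_largeEntries_le s
  have h4 : D * ((largeEntries x s).card : ℝ) ≤ t * n / 8 := by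
    have e1 : lam * t * ((largeEntries x s).card : ℝ) ≤ 8 * D ^ 2 * n := by
      have : lam * s * (largeEntries x s).card * (8 * D) =
        lam * t * ((largeEntries x s).card : ℝ) := by
        simp only [s]; field_simp
      nlinarith
    have e2 : (lam * t) * (D * ((largeEntries x s).card : ℝ)) ≤ (lam * t) * (t * n / 8) := by
      nlinarith
    exact le_of_mul_le_mul_left e2 (by positivity)
  have h5 : s * (D * n) = t * n / 8 := by
    simp only [s]; field_simp
  have h6 : n / 2 * t ≤ lam ^ 2 * x u :=
    mul_le_mul h.card_div_two_le hu ht.le (by positivity)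
  linarith

/-- Large entries have linear degree and the degree sum is linear, so the bound is independent of
the number of vertices. -/
theorem card_largeEntries_le (h : IsSparseEigenpair G γ D T lam x) {t : ℝ} (ht : 0 < t)
    (hlam : 64 * (D : ℝ) ^ 3 ≤ lam * t ^ 2) :
    ((largeEntries x t).card : ℝ) ≤ 4 * D ^ 2 / t := by
  have hn := h.card_pos
  have h1 : ((largeEntries x t).card : ℝ) * (t * Fintype.card W) ≤
      4 * D * (D * Fintype.card W) := by
    calc ((largeEntries x t).card : ℝ) * (t * Fintype.card W)
        = ∑ v ∈ largeEntries x t, t * (Fintype.card W : ℝ) := by simp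
      _ ≤ ∑ v ∈ largeEntries x t, 4 * D * ((nbrsIn G Finset.univ v).card : ℝ) :=
          Finset.sum_le_sum fun v hv => h.degree_ge_of_le ht hlam (mem_largeEntries.mp hv)
      _ ≤ _ := by
          rw [← Finset.mul_sum]
          exact mul_le_mul_of_nonneg_left (h.sum_degrees_le _) (by positivity)
  rw [le_div_iff₀ ht]
  refine le_of_mul_le_mul_right ?_ hn
  linarith

/-- Each vertex of `Z` is a common neighbour of some `γ + 1` vertices of `A`, and each such choice
serves fewer than `T` vertices. -/
theorem card_many_nbrs_le (h : IsSparseEigenpair G γ D T lam x) (A Z : Finset W)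
    (hZ : ∀ v ∈ Z, γ < (nbrsIn G A v).card) : Z.card ≤ 2 ^ A.card * T := by
  classical
  have hsub : Z ⊆ (A.powersetCard (γ + 1)).biUnion fun P => {v | ∀ l ∈ P, G.Adj l v} := by
    intro v hv
    obtain ⟨P, hP, hPc⟩ := Finset.exists_subset_card_eq (Nat.succ_le_of_lt (hZ v hv))
    simp only [Finset.mem_biUnion, Finset.mem_powersetCard, Finset.mem_filter, Finset.mem_univ,
      true_and]
    exact ⟨P, ⟨fun w hw => (mem_nbrsIn.mp (hP hw)).1, hPc⟩,
      fun l hl => (mem_nbrsIn.mp (hP hl)).2.symm⟩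
  refine (Finset.card_le_card hsub).trans ?_
  refine (Finset.card_biUnion_le_card_mul _ _ T fun P hP => ?_).trans ?_
  · exact (h.common P _ (Finset.mem_powersetCard.mp hP).2 (by simp)).le
  · refine Nat.mul_le_mul_right _ ?_
    rw [← Finset.card_powerset]
    exact Finset.card_le_card fun P hP =>
      Finset.mem_powerset.mpr (Finset.mem_powersetCard.mp hP).1

/-- There are `γ` vertices of almost full degree whose entries are almost `1`. -/
theorem exists_hubs (h : IsSparseEigenpair G γ D T lam x) {η t : ℝ} {q : ℕ} (hη : 0 < η)
    (hη1 : η ≤ 1) (ht : t = η / (4 * D)) (hlam : 64 * (D : ℝ) ^ 3 ≤ lam * t ^ 2)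
    (hq : 4 * (D : ℝ) ^ 2 / t ≤ q)
    (hn : (2 ^ q * T * q : ℕ) + (γ : ℝ) ^ 2 ≤ η * Fintype.card W / 4) :
    ∃ L : Finset W, L.card = γ ∧ ∀ w ∈ L, 1 - η < x w ∧
      (1 - 2 * η) * Fintype.card W ≤ (nbrsIn G Finset.univ w).card := by
  classical
  have hD : (1 : ℝ) ≤ D := by exact_mod_cast h.one_le_density
  have hγ : (1 : ℝ) ≤ γ := by exact_mod_cast h.one_le_gamma
  have hn0 := h.card_pos
  have ht0 : 0 < t := by rw [ht]; positivity
  set n : ℝ := (Fintype.card W : ℝ) with hndef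
  set A := largeEntries x t
  have hAq : A.card ≤ q := by exact_mod_cast (h.card_largeEntries_le ht0 hlam).trans hq
  let Z : Finset W := {v | γ < (nbrsIn G A v).card}
  have hZcard : Z.card ≤ 2 ^ q * T :=
    (h.card_many_nbrs_le A Z (by simp [Z])).trans
      (Nat.mul_le_mul_right _ (Nat.pow_le_pow_right two_pos hAq))
  have hS : ∀ v, ∑ w ∈ nbrsIn G A v, x w ≤ (nbrsIn G A v).card := fun v =>
    (Finset.sum_le_sum fun w _ => h.le_one w).trans (by simp)
  have hS0 : ∀ v, 0 ≤ ∑ w ∈ nbrsIn G A v, x w := fun v => Finset.sum_nonneg fun w _ => h.nonneg w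
  -- Half of the error `η * n / 2` comes from small entries, half from `Z` and from replacing `n -
  -- γ` by `n`.
  have hmain : ∀ u, γ * n * x u ≤
      ∑ v ∈ nbrsIn G Finset.univ u \ Z, ∑ w ∈ nbrsIn G A v, x w + η * n / 2 := by
    intro u
    have h1 := h.lam_sq_mul_le ht0.le u
    have h2 : ∑ v ∈ nbrsIn G Finset.univ u, ∑ w ∈ nbrsIn G A v, x w ≤
        ∑ v ∈ nbrsIn G Finset.univ u \ Z, ∑ w ∈ nbrsIn G A v, x w + (2 ^ q * T * q : ℕ) := by
      rw [← Finset.sum_inter_add_sum_sdiff _ Z, add_comm]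
      gcongr
      calc ∑ v ∈ nbrsIn G Finset.univ u ∩ Z, ∑ w ∈ nbrsIn G A v, x w
          ≤ ∑ v ∈ Z, ∑ w ∈ nbrsIn G A v, x w :=
            Finset.sum_le_sum_of_subset_of_nonneg Finset.inter_subset_right fun v _ _ => hS0 v
        _ ≤ ∑ v ∈ Z, (q : ℝ) := by
            refine Finset.sum_le_sum fun v _ => (hS v).trans ?_
            exact_mod_cast (Finset.card_le_card fun w hw => (mem_nbrsIn.mp hw).1).trans hAq
        _ = ((Z.card * q : ℕ) : ℝ) := by simp
        _ ≤ (2 ^ q * T * q : ℕ) := by exact_mod_cast Nat.mul_le_mul_right _ hZcard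
    have h3 : t * (D * n) = η * n / 4 := by
      rw [ht]; field_simp
    have h4 : γ * (n - γ) * x u ≤ lam ^ 2 * x u :=
      mul_le_mul_of_nonneg_right h.lam_sq (h.nonneg u)
    have h5 : (γ : ℝ) ^ 2 * x u ≤ γ ^ 2 :=
      mul_le_of_le_one_right (by positivity) (h.le_one u)
    nlinarith
  have hnotZ : ∀ v, v ∉ Z → (nbrsIn G A v).card ≤ γ := fun v hv => by simpa [Z] using hv
  obtain ⟨u, hu⟩ := h.exists_one
  -- Averaging at a vertex of entry 1. Such a `v` sees exactly `γ` large entries, all nearly 1;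
  -- these are the hubs.
  have hex : ∃ v, v ∉ Z ∧ γ - η < ∑ w ∈ nbrsIn G A v, x w := by
    by_contra! hcon
    have h1 := hmain u
    have h2 : ∑ v ∈ nbrsIn G Finset.univ u \ Z, ∑ w ∈ nbrsIn G A v, x w ≤ n * (γ - η) := by
      calc _ ≤ ∑ v ∈ nbrsIn G Finset.univ u \ Z, ((γ : ℝ) - η) :=
            Finset.sum_le_sum fun v hv => hcon v (Finset.mem_sdiff.mp hv).2
        _ ≤ ∑ v : W, ((γ : ℝ) - η) :=
            Finset.sum_le_sum_of_subset_of_nonneg (Finset.subset_univ _)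
              fun _ _ _ => by linarith
        _ = n * (γ - η) := by simp [hndef]; ring
    rw [hu] at h1
    nlinarith
  obtain ⟨v, hvZ, hv⟩ := hex
  have hcard : (nbrsIn G A v).card = γ := by
    refine le_antisymm (hnotZ v hvZ) ?_
    have h1 : (γ : ℝ) < (nbrsIn G A v).card + 1 := by linarith [hS v]
    have h2 : γ < (nbrsIn G A v).card + 1 := by exact_mod_cast h1
    omega
  refine ⟨nbrsIn G A v, hcard, fun w hw => ?_⟩
  have hxw : 1 - η < x w := by
    have h1 := Finset.add_sum_erase (nbrsIn G A v) x hw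
    have h2 : ∑ z ∈ (nbrsIn G A v).erase w, x z ≤ γ - 1 := by
      refine (Finset.sum_le_sum fun z _ => h.le_one z).trans ?_
      have := Finset.card_erase_add_one hw
      rw [hcard] at this
      have : (((nbrsIn G A v).erase w).card : ℝ) + 1 = γ := by exact_mod_cast this
      simp only [Finset.sum_const, nsmul_eq_mul, mul_one]
      linarith
    linarith
  refine ⟨hxw, ?_⟩
  -- The same inequality at a hub: its neighbours outside `Z` contribute at most `γ` each, so there
  -- must be almost `n` of them.
  have h1 := hmain w
  have h2 : ∑ v ∈ nbrsIn G Finset.univ w \ Z, ∑ w ∈ nbrsIn G A v, x w ≤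
      (nbrsIn G Finset.univ w).card * γ := by
    calc _ ≤ ∑ v ∈ nbrsIn G Finset.univ w \ Z, (γ : ℝ) := by
          refine Finset.sum_le_sum fun v hv => (hS v).trans ?_
          exact_mod_cast hnotZ v (Finset.mem_sdiff.mp hv).2
      _ ≤ ∑ v ∈ nbrsIn G Finset.univ w, (γ : ℝ) :=
          Finset.sum_le_sum_of_subset_of_nonneg Finset.sdiff_subset fun _ _ _ => by linarith
      _ = _ := by simp
  have h3 : γ * n * (1 - η) ≤ γ * n * x w := mul_le_mul_of_nonneg_left hxw.le (by positivity)
  have h4 : η * n / 2 ≤ γ * (η * n) := by nlinarith [mul_pos hη hn0]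
  refine le_of_mul_le_mul_left (a := (γ : ℝ)) ?_ (by linarith)
  linarith

theorem lam_mul_sq_ge (h : IsSparseEigenpair G γ D T lam x) {t : ℝ} (ht : 0 < t)
    (hn : 2 * (64 * (D : ℝ) ^ 3 / t ^ 2) ^ 2 ≤ Fintype.card W) :
    64 * (D : ℝ) ^ 3 ≤ lam * t ^ 2 := by
  rw [← div_le_iff₀ (by positivity)]
  refine le_of_sq_le_sq ?_ h.lam_nonneg
  linarith [h.card_div_two_le]

end IsSparseEigenpair

/-! ### The twin modification and its quadratic form -/

/-- The graph obtained from `G` by making `L` a clique and giving every vertex of `K` the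
neighbourhood `L`. -/
def twinGraph {W : Type*} (G : SimpleGraph W) (L K : Finset W) : SimpleGraph W where
  Adj u v := u ≠ v ∧ ((u ∈ L ∧ v ∈ L) ∨ (u ∈ K ∧ v ∈ L) ∨ (u ∈ L ∧ v ∈ K) ∨
    (u ∉ K ∧ v ∉ K ∧ G.Adj u v))
  symm := ⟨fun u v h => ⟨h.1.symm, by have := h.2; rw [G.adj_comm v u]; tauto⟩⟩
  loopless := ⟨fun u h => h.1 rfl⟩

theorem twinGraph_adj {W : Type*} {G : SimpleGraph W} {L K : Finset W} {u v : W} :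
    (twinGraph G L K).Adj u v ↔ u ≠ v ∧ ((u ∈ L ∧ v ∈ L) ∨ (u ∈ K ∧ v ∈ L) ∨ (u ∈ L ∧ v ∈ K) ∨
      (u ∉ K ∧ v ∉ K ∧ G.Adj u v)) := Iff.rfl

/-- The quadratic form of a twin graph at a vector obtained from an eigenvector of `G` by changing
one entry. -/
theorem twinGraph_quadratic_form_ge {W : Type*} [Fintype W] [DecidableEq W] {G : SimpleGraph W}
    {lam : ℝ} {x : W → ℝ} (hx : ∀ u, 0 ≤ x u) (hlam : 0 < lam)
    (heig : ∀ u, ∑ w ∈ nbrsIn G Finset.univ u, x w = lam * x u) (L R : Finset W) (v : W)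
    (hRL : Disjoint R L) (hvL : v ∉ L) (hvR : v ∉ R) (hR : ∀ r ∈ R, ∀ l ∈ L, G.Adj l r) :
    lam * ∑ u, Function.update x v ((∑ l ∈ L, x l) / lam) u ^ 2 +
      ((∑ l ∈ L, x l) ^ 2 / lam - lam * x v ^ 2 +
        ∑ u ∈ L, x u * ∑ w ∈ L.erase u \ nbrsIn G Finset.univ u, x w -
        2 * ∑ r ∈ R, x r * ∑ w ∈ nbrsIn G Finset.univ r \ L, x w) ≤
      ∑ u, ∑ w ∈ nbrsIn (twinGraph G L (insert v R)) Finset.univ u,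
        Function.update x v ((∑ l ∈ L, x l) / lam) u *
          Function.update x v ((∑ l ∈ L, x l) / lam) w := by
  classical
  set Λ := ∑ l ∈ L, x l with hΛ
  -- The new entry at `v` solves the eigenvalue equation there, so `v` has no defect.
  set c := Λ / lam with hc
  set y := Function.update x v c with hy
  set N : W → Finset W := nbrsIn G Finset.univ with hN
  set N' : W → Finset W := nbrsIn (twinGraph G L (insert v R)) Finset.univ with hN'
  have hc0 : 0 ≤ c := div_nonneg (Finset.sum_nonneg fun l _ => hx l) hlam.le
  have hyv : y v = c := Function.update_self ..
  have hyx : ∀ u, u ≠ v → y u = x u := fun u hu => Function.update_of_ne hu ..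
  have hy0 : ∀ u, 0 ≤ y u := by
    intro u
    by_cases hu : u = v
    · rw [hu, hyv]; exact hc0
    · rw [hyx u hu]; exact hx u
  have hlc : lam * c = Λ := by rw [hc]; field_simp
  have hRL' : ∀ r ∈ R, r ∉ L := fun r hr => Finset.disjoint_left.mp hRL hr
  have hyL : ∑ l ∈ L, y l = Λ :=
    Finset.sum_congr rfl fun l hl => hyx l fun h => hvL (h ▸ hl)
  have hNK : ∀ u, u ∈ insert v R → N' u = L := by
    intro u hu
    have huL : u ∉ L := by
      rcases Finset.mem_insert.mp hu with rfl | h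
      · exact hvL
      · exact hRL' u h
    ext w
    simp only [hN', mem_nbrsIn, Finset.mem_univ, true_and, twinGraph_adj]
    refine ⟨fun h => ?_, fun h => ⟨fun h' => huL (h' ▸ h), Or.inr (Or.inl ⟨hu, h⟩)⟩⟩
    tauto
  -- The defect of `y` at `u`; it is bounded separately on `v`, `R`, `L` and the rest `Q`.
  let f : W → ℝ := fun u => ∑ w ∈ N' u, y u * y w - lam * y u ^ 2
  have hf : ∀ u, f u = y u * (∑ w ∈ N' u, y w - lam * y u) := by
    intro u
    simp only [f]
    rw [← Finset.mul_sum]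
    ring
  let a : W → ℝ := fun u => if G.Adj u v then x v else 0
  have ha : ∀ u, ∑ w ∈ N u \ {v}, x w = lam * x u - a u := by
    intro u
    rw [← heig u, ← Finset.sum_inter_add_sum_sdiff (nbrsIn G Finset.univ u) {v} x]
    have : ∑ w ∈ nbrsIn G Finset.univ u ∩ {v}, x w = a u := by
      simp only [a]
      split_ifs with h
      · rw [Finset.inter_singleton_of_mem (by simpa using h), Finset.sum_singleton]
      · rw [Finset.inter_singleton_of_notMem (by simpa using h), Finset.sum_empty]
    rw [this]
    ring
  have fv : f v = 0 := by
    rw [hf, hNK v (Finset.mem_insert_self _ _), hyL, hyv, hlc]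
    ring
  have fR : ∀ r ∈ R, f r = - (x r * ∑ w ∈ N r \ L, x w) := by
    intro r hr
    have hsub : L ⊆ N r := fun l hl => by simpa [hN] using (hR r hr l hl).symm
    rw [hf, hNK r (Finset.mem_insert_of_mem hr), hyL, hyx r (fun h => hvR (h ▸ hr)), ← heig r,
      ← Finset.sum_sdiff hsub]
    ring
  have fL : ∀ u ∈ L, x u * (c - a u + ∑ w ∈ L.erase u \ N u, x w) ≤ f u := by
    intro u hu
    have huv : u ≠ v := fun h => hvL (h ▸ hu)
    have huK : u ∉ insert v R := by
      rw [Finset.mem_insert, not_or]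
      exact ⟨huv, fun h => hRL' u h hu⟩
    rw [hf, hyx u huv]
    refine mul_le_mul_of_nonneg_left ?_ (hx u)
    have hsub : insert v ((N u \ {v}) ∪ (L.erase u \ N u)) ⊆ N' u := by
      intro w hw
      simp only [hN, Finset.mem_insert, Finset.mem_union, Finset.mem_sdiff, mem_nbrsIn,
        Finset.mem_univ, true_and, Finset.mem_singleton, Finset.mem_erase] at hw
      simp only [hN', mem_nbrsIn, Finset.mem_univ, true_and, twinGraph_adj]
      rcases hw with rfl | ⟨h1, h2⟩ | ⟨⟨h1, h2⟩, h3⟩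
      · exact ⟨huv, Or.inr (Or.inr (Or.inl ⟨hu, Finset.mem_insert_self _ _⟩))⟩
      · refine ⟨h1.ne, ?_⟩
        tauto
      · exact ⟨h1.symm, Or.inl ⟨hu, h2⟩⟩
    have h1 := Finset.sum_le_sum_of_subset_of_nonneg hsub fun w _ _ => hy0 w
    have hnot : v ∉ (N u \ {v}) ∪ (L.erase u \ N u) := by simp [hvL]
    rw [Finset.sum_insert hnot, Finset.sum_union, hyv] at h1
    · have e1 : ∑ w ∈ N u \ {v}, y w = lam * x u - a u := by
        rw [← ha u]
        exact Finset.sum_congr rfl fun w hw => hyx w (by simp at hw; exact hw.2)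
      have e2 : ∑ w ∈ L.erase u \ N u, y w = ∑ w ∈ L.erase u \ N u, x w := by
        refine Finset.sum_congr rfl fun w hw => hyx w fun h => hvL ?_
        subst h
        exact Finset.mem_of_mem_erase (Finset.mem_sdiff.mp hw).1
      linarith
    · exact Finset.disjoint_sdiff.mono_left Finset.sdiff_subset
  let Q : Finset W := (insert v (R ∪ L))ᶜ
  have fQ : ∀ u ∈ Q, -(x u * ∑ w ∈ nbrsIn G R u, x w) - x u * a u ≤ f u := by
    intro u hu
    simp only [Q, Finset.mem_compl, Finset.mem_insert, Finset.mem_union, not_or] at hu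
    obtain ⟨huv, huR, huL⟩ := hu
    rw [hf, hyx u huv]
    have hsub : (N u \ {v}) \ R ⊆ N' u := by
      intro w hw
      simp only [hN, Finset.mem_sdiff, mem_nbrsIn,
        Finset.mem_univ, true_and, Finset.mem_singleton] at hw
      simp only [hN', mem_nbrsIn, Finset.mem_univ, true_and, twinGraph_adj, Finset.mem_insert]
      refine ⟨hw.1.1.ne, ?_⟩
      tauto
    have h1 := Finset.sum_le_sum_of_subset_of_nonneg hsub fun w _ _ => hy0 w
    have e1 : ∑ w ∈ (N u \ {v}) \ R, y w = ∑ w ∈ (N u \ {v}) \ R, x w :=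
      Finset.sum_congr rfl fun w hw => hyx w (by simp at hw; exact hw.1.2)
    have h2 := Finset.sum_inter_add_sum_sdiff (N u \ {v}) R x
    have h3 : ∑ w ∈ (N u \ {v}) ∩ R, x w ≤ ∑ w ∈ nbrsIn G R u, x w := by
      refine Finset.sum_le_sum_of_subset_of_nonneg (fun w hw => ?_) fun w _ _ => hx w
      simp [hN] at hw ⊢
      exact ⟨hw.2, hw.1.1⟩
    rw [ha u] at h2
    have h4 : -∑ w ∈ nbrsIn G R u, x w - a u ≤ ∑ w ∈ N' u, y w - lam * x u := by linarith
    have := mul_le_mul_of_nonneg_left h4 (hx u)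
    linarith
  have hsum : ∑ u, f u = f v + (∑ r ∈ R, f r + ∑ l ∈ L, f l) + ∑ u ∈ Q, f u := by
    rw [← Finset.sum_add_sum_compl (insert v (R ∪ L)) f, Finset.sum_insert (by simp [hvL, hvR]),
      Finset.sum_union hRL]
  -- Deleted edges at `R` are charged from both ends, whence the factor 2 in the statement.
  have hswap : ∑ u ∈ Q, x u * ∑ w ∈ nbrsIn G R u, x w ≤ ∑ r ∈ R, x r * ∑ w ∈ N r \ L, x w := by
    have e : ∑ u ∈ Q, x u * ∑ w ∈ nbrsIn G R u, x w = ∑ r ∈ R, x r * ∑ w ∈ nbrsIn G Q r, x w := by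
      simp only [Finset.mul_sum]
      rw [Finset.sum_comm' (t' := R) (s' := fun r => nbrsIn G Q r)]
      · exact Finset.sum_congr rfl fun r _ => Finset.sum_congr rfl fun u _ => mul_comm _ _
      · intro u w
        simp only [mem_nbrsIn, G.adj_comm w u]
        tauto
    rw [e]
    refine Finset.sum_le_sum fun r _ => mul_le_mul_of_nonneg_left ?_ (hx r)
    refine Finset.sum_le_sum_of_subset_of_nonneg (fun w hw => ?_) fun w _ _ => hx w
    simp [hN, Q] at hw ⊢
    tauto
  have hav : ∑ u ∈ L, x u * a u + ∑ u ∈ Q, x u * a u ≤ lam * x v ^ 2 := by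
    have hdis : Disjoint L Q := by
      rw [Finset.disjoint_left]
      intro u hu
      simp [Q, hu]
    rw [← Finset.sum_union hdis, sq, ← mul_assoc, ← heig v, Finset.sum_mul]
    have e : ∀ u, x u * a u = if u ∈ N v then x u * x v else 0 := by
      intro u
      simp only [a, hN, mem_nbrsIn, Finset.mem_univ, true_and, G.adj_comm v u, mul_ite, mul_zero]
    simp only [e]
    rw [← Finset.sum_filter]
    refine Finset.sum_le_sum_of_subset_of_nonneg (fun w hw => ?_)
      fun w _ _ => mul_nonneg (hx w) (hx v)
    exact (Finset.mem_filter.mp hw).2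
  have hL := Finset.sum_le_sum fL
  have hQ := Finset.sum_le_sum fQ
  rw [Finset.sum_sub_distrib, Finset.sum_neg_distrib] at hQ
  have eL : ∑ u ∈ L, x u * (c - a u + ∑ w ∈ L.erase u \ N u, x w) =
      Λ ^ 2 / lam - ∑ u ∈ L, x u * a u + ∑ u ∈ L, x u * ∑ w ∈ L.erase u \ N u, x w := by
    have : Λ ^ 2 / lam = ∑ u ∈ L, x u * c := by
      rw [← Finset.sum_mul, ← hΛ, hc]; ring
    rw [this, ← Finset.sum_sub_distrib, ← Finset.sum_add_distrib]
    exact Finset.sum_congr rfl fun u _ => by ring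
  have eR : ∑ r ∈ R, f r = -∑ r ∈ R, x r * ∑ w ∈ N r \ L, x w := by
    rw [← Finset.sum_neg_distrib]
    exact Finset.sum_congr rfl fR
  have htot : ∑ u, f u = ∑ u, ∑ w ∈ N' u, y u * y w - lam * ∑ u, y u ^ 2 := by
    simp only [f]
    rw [Finset.sum_sub_distrib, Finset.mul_sum]
  linarith

/-! ### Non-hubs and exceptional vertices -/

open Classical in
/-- The common neighbours of the vertices of `L`. -/
noncomputable def commonNbrs {W : Type*} [Fintype W] (G : SimpleGraph W) (L : Finset W) :
    Finset W :=
  {v | ∀ l ∈ L, G.Adj l v}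

@[simp]
theorem mem_commonNbrs {W : Type*} [Fintype W] {G : SimpleGraph W} {L : Finset W} {v : W} :
    v ∈ commonNbrs G L ↔ ∀ l ∈ L, G.Adj l v := by
  simp [commonNbrs]

theorem card_compl_commonNbrs_le {W : Type*} [Fintype W] [DecidableEq W] (G : SimpleGraph W)
    (L : Finset W) (δ : ℝ)
    (hL : ∀ l ∈ L, (1 - δ) * Fintype.card W ≤ (nbrsIn G Finset.univ l).card) :
    (((commonNbrs G L)ᶜ).card : ℝ) ≤ L.card * (δ * Fintype.card W) := by
  have hsub : (commonNbrs G L)ᶜ ⊆ L.biUnion fun l => (nbrsIn G Finset.univ l)ᶜ := by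
    intro v hv
    simpa using hv
  calc (((commonNbrs G L)ᶜ).card : ℝ) ≤ ∑ l ∈ L, (((nbrsIn G Finset.univ l)ᶜ).card : ℝ) := by
        exact_mod_cast (Finset.card_le_card hsub).trans Finset.card_biUnion_le
    _ ≤ ∑ l ∈ L, δ * (Fintype.card W : ℝ) := by
        refine Finset.sum_le_sum fun l hl => ?_
        have h1 : (((nbrsIn G Finset.univ l)ᶜ).card : ℝ) + (nbrsIn G Finset.univ l).card =
            Fintype.card W := by
          exact_mod_cast Finset.card_compl_add_card _
        linarith [hL l hl]
    _ = L.card * (δ * Fintype.card W) := by simp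

namespace IsSparseEigenpair

variable {W : Type*} [Fintype W] {G : SimpleGraph W} {γ D T : ℕ} {lam : ℝ} {x : W → ℝ}

/-- Otherwise `w` together with the `γ` hubs would be `γ + 1` vertices with `T` common neighbours.
-/
theorem card_nbrsIn_commonNbrs_lt (h : IsSparseEigenpair G γ D T lam x) {L : Finset W}
    (hL : L.card = γ) {w : W} (hw : w ∉ L) : (nbrsIn G (commonNbrs G L) w).card < T := by
  classical
  refine h.common (insert w L) _ (by rw [Finset.card_insert_of_notMem hw, hL]) fun s hs l hl => ?_
  rw [mem_nbrsIn, mem_commonNbrs] at hs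
  rcases Finset.mem_insert.mp hl with rfl | hl
  · exact hs.2
  · exact hs.1 l hl

/-- An entry at least `t` needs linear degree, but `w` has fewer than `T` neighbours among the
common neighbours of `L`, and few vertices lie outside these. -/
theorem lt_of_notMem_hubs (h : IsSparseEigenpair G γ D T lam x) {L : Finset W}
    (hL : L.card = γ) {δ t : ℝ} (ht : 0 < t) (hlam : 64 * (D : ℝ) ^ 3 ≤ lam * t ^ 2)
    (hdeg : ∀ l ∈ L, (1 - δ) * Fintype.card W ≤ (nbrsIn G Finset.univ l).card)
    (hδ : 16 * D * (γ * δ) ≤ t) (hT : 16 * D * (T : ℝ) ≤ t * Fintype.card W) {w : W}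
    (hw : w ∉ L) : x w < t := by
  classical
  by_contra! hcon
  have hn := h.card_pos
  have h1 := h.degree_ge_of_le ht hlam hcon
  have h2 := card_compl_commonNbrs_le G L δ hdeg
  have h3 := h.card_nbrsIn_commonNbrs_lt hL hw
  have h4 : (nbrsIn G Finset.univ w).card ≤
      (nbrsIn G (commonNbrs G L) w).card + ((commonNbrs G L)ᶜ).card := by
    refine (Finset.card_le_card fun z hz => ?_).trans (Finset.card_union_le _ _)
    simp only [mem_nbrsIn, Finset.mem_union, Finset.mem_compl] at hz ⊢
    tauto
  have h5 : ((nbrsIn G Finset.univ w).card : ℝ) ≤ T + γ * (δ * Fintype.card W) := by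
    have : ((nbrsIn G Finset.univ w).card : ℝ) ≤ T + ((commonNbrs G L)ᶜ).card := by
      exact_mod_cast h4.trans (by omega)
    rw [hL] at h2
    linarith
  have h6 : 4 * D * ((nbrsIn G Finset.univ w).card : ℝ) ≤
      4 * D * (T + γ * (δ * Fintype.card W)) := mul_le_mul_of_nonneg_left h5 (by positivity)
  have h7 := mul_le_mul_of_nonneg_right hδ hn.le
  nlinarith [mul_pos ht hn]

/-- Some vertex outside the hubs `L` and their common neighbourhood has little weight around it. -/
theorem exists_light_exceptional (h : IsSparseEigenpair G γ D T lam x) [DecidableEq W]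
    {L : Finset W} (hL : L.card = γ) {δ t : ℝ} (ht : 0 < t)
    (hdeg : ∀ l ∈ L, (1 - δ) * Fintype.card W ≤ (nbrsIn G Finset.univ l).card)
    (hsmall : ∀ w ∉ L, x w < t) (hTt : T * t ≤ 1 / 8)
    (hδ : (8 * (γ : ℝ) + 2) ^ 2 * D * (γ * δ) < 1 / 2)
    (hne : ((commonNbrs G L)ᶜ \ L).Nonempty) :
    ∃ v ∈ (commonNbrs G L)ᶜ \ L, ∑ w ∈ nbrsIn G Finset.univ v \ L, x w ≤ 1 / 4 := by
  by_contra! hcon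
  set E := (commonNbrs G L)ᶜ \ L
  have hn := h.card_pos
  have hl := h.lam_pos
  have hE0 : ∀ v, 0 ≤ ∑ w ∈ nbrsIn G E v, x w := fun v => Finset.sum_nonneg fun w _ => h.nonneg w
  have hout : ∀ v ∈ E, ∑ w ∈ nbrsIn G Finset.univ v \ L, x w ≤ 1 / 8 + ∑ w ∈ nbrsIn G E v, x w := by
    intro v hv
    have hvL : v ∉ L := (Finset.mem_sdiff.mp hv).2
    have hsub : nbrsIn G Finset.univ v \ L ⊆
        (nbrsIn G (commonNbrs G L) v \ L) ∪ nbrsIn G E v := by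
      intro w hw
      simp only [E, mem_nbrsIn, Finset.mem_union, Finset.mem_sdiff, Finset.mem_compl] at hw ⊢
      tauto
    have h1 : ∑ w ∈ nbrsIn G (commonNbrs G L) v \ L, x w ≤ 1 / 8 := by
      calc _ ≤ ∑ w ∈ nbrsIn G (commonNbrs G L) v \ L, t :=
            Finset.sum_le_sum fun w hw => (hsmall w (Finset.mem_sdiff.mp hw).2).le
        _ ≤ ∑ w ∈ nbrsIn G (commonNbrs G L) v, t :=
            Finset.sum_le_sum_of_subset_of_nonneg Finset.sdiff_subset fun _ _ _ => ht.le
        _ = (nbrsIn G (commonNbrs G L) v).card * t := by simp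
        _ ≤ T * t := by
            have := (h.card_nbrsIn_commonNbrs_lt hL hvL).le
            gcongr
        _ ≤ _ := hTt
    calc _ ≤ ∑ w ∈ (nbrsIn G (commonNbrs G L) v \ L) ∪ nbrsIn G E v, x w :=
          Finset.sum_le_sum_of_subset_of_nonneg hsub fun w _ _ => h.nonneg w
      _ ≤ ∑ w ∈ nbrsIn G (commonNbrs G L) v \ L, x w + ∑ w ∈ nbrsIn G E v, x w := by
          rw [← Finset.sum_union_inter]
          have := Finset.sum_nonneg (s := (nbrsIn G (commonNbrs G L) v \ L) ∩ nbrsIn G E v)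
            fun w _ => h.nonneg w
          linarith
      _ ≤ _ := by linarith
  have hσ : ∀ v ∈ E, 1 / 8 < ∑ w ∈ nbrsIn G E v, x w := fun v hv => by
    linarith [hcon v hv, hout v hv]
  -- If every exceptional vertex is heavy, its weight inside `E` exceeds 1/8 and absorbs the at most
  -- `γ + 1/8` coming from outside `E`.
  have hlx : ∀ v ∈ E, lam * x v ≤ (8 * γ + 2) * ∑ w ∈ nbrsIn G E v, x w := by
    intro v hv
    rw [← h.eigen v, ← Finset.sum_inter_add_sum_sdiff (nbrsIn G Finset.univ v) L]
    have h1 : ∑ w ∈ nbrsIn G Finset.univ v ∩ L, x w ≤ γ := by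
      calc _ ≤ ∑ w ∈ nbrsIn G Finset.univ v ∩ L, (1 : ℝ) :=
            Finset.sum_le_sum fun w _ => h.le_one w
        _ ≤ ∑ w ∈ L, (1 : ℝ) :=
            Finset.sum_le_sum_of_subset_of_nonneg Finset.inter_subset_right
              fun _ _ _ => zero_le_one
        _ = γ := by simp [hL]
    have h2 := hout v hv
    have h3 := hσ v hv
    have h4 : (0 : ℝ) ≤ γ := by positivity
    nlinarith
  obtain ⟨u, hu, hmax⟩ := Finset.exists_max_image E x hne
  have hu0 : 0 < x u := by
    by_contra! h0
    have h1 : ∑ w ∈ nbrsIn G E u, x w ≤ 0 :=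
      Finset.sum_nonpos fun w hw => (hmax w (mem_nbrsIn.mp hw).1).trans h0
    linarith [hσ u hu]
  -- Iterating twice at the largest entry of `E` bounds `lam ^ 2` by 2-walks inside the sparse set
  -- `E`, which is too small for `lam ^ 2 ≥ n / 2`.
  have h1 : lam ^ 2 * x u ≤ (8 * γ + 2) ^ 2 * (D * E.card * x u) := by
    calc lam ^ 2 * x u = lam * (lam * x u) := by ring
      _ ≤ lam * ((8 * γ + 2) * ∑ w ∈ nbrsIn G E u, x w) :=
          mul_le_mul_of_nonneg_left (hlx u hu) hl.le
      _ = (8 * γ + 2) * ∑ w ∈ nbrsIn G E u, lam * x w := by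
          rw [← Finset.mul_sum]; ring
      _ ≤ (8 * γ + 2) * ∑ w ∈ nbrsIn G E u, (8 * γ + 2) * ((nbrsIn G E w).card * x u) := by
          refine mul_le_mul_of_nonneg_left (Finset.sum_le_sum fun w hw => ?_) (by positivity)
          refine (hlx w (mem_nbrsIn.mp hw).1).trans ?_
          refine mul_le_mul_of_nonneg_left ?_ (by positivity)
          refine (Finset.sum_le_sum fun z hz => hmax z (mem_nbrsIn.mp hz).1).trans ?_
          simp
      _ = (8 * γ + 2) ^ 2 * ((∑ w ∈ nbrsIn G E u, ((nbrsIn G E w).card : ℝ)) * x u) := by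
          rw [← Finset.mul_sum, ← Finset.sum_mul]; ring
      _ ≤ (8 * γ + 2) ^ 2 * (D * E.card * x u) := by
          have := (sum_card_nbrsIn_le_adjCount (G := G) (S := E) (A := nbrsIn G E u) (B := E)
            (fun w hw => (mem_nbrsIn.mp hw).1) (Finset.Subset.refl _)).trans (h.sparse E)
          have h2 : ∑ w ∈ nbrsIn G E u, ((nbrsIn G E w).card : ℝ) ≤ D * E.card := by
            exact_mod_cast this
          gcongr
  have h2 : lam ^ 2 ≤ (8 * γ + 2) ^ 2 * (D * E.card) := by
    refine le_of_mul_le_mul_right ?_ hu0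
    linarith
  have h3 : (E.card : ℝ) ≤ γ * (δ * Fintype.card W) := by
    have := card_compl_commonNbrs_le G L δ hdeg
    rw [hL] at this
    refine le_trans ?_ this
    exact_mod_cast Finset.card_le_card Finset.sdiff_subset
  have h4 : (8 * (γ : ℝ) + 2) ^ 2 * (D * E.card) ≤
      (8 * (γ : ℝ) + 2) ^ 2 * (D * (γ * (δ * Fintype.card W))) := by gcongr
  have h5 := mul_lt_mul_of_pos_right hδ hn
  have h6 := h.card_div_two_le
  nlinarith

/-- Many common neighbours of the hubs have bounded degree. -/
theorem exists_low_degree (h : IsSparseEigenpair G γ D T lam x)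
    {L : Finset W} (hL : L.card = γ) {δ : ℝ} {m : ℕ}
    (hdeg : ∀ l ∈ L, (1 - δ) * Fintype.card W ≤ (nbrsIn G Finset.univ l).card)
    (hδ : γ * δ ≤ 1 / 4) (hm : (m : ℝ) ≤ Fintype.card W / 2) :
    ∃ R ⊆ commonNbrs G L, R.card = m ∧ ∀ r ∈ R, (nbrsIn G Finset.univ r).card ≤ 4 * D := by
  classical
  have hn := h.card_pos
  have hD : (1 : ℝ) ≤ D := by exact_mod_cast h.one_le_density
  let B : Finset W := {v | 4 * D < (nbrsIn G Finset.univ v).card}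
  have hB : (B.card : ℝ) ≤ Fintype.card W / 4 := by
    have h1 : (B.card : ℝ) * (4 * D) ≤ D * Fintype.card W := by
      calc (B.card : ℝ) * (4 * D) = ∑ v ∈ B, (4 * D : ℝ) := by simp
        _ ≤ ∑ v ∈ B, ((nbrsIn G Finset.univ v).card : ℝ) := by
            refine Finset.sum_le_sum fun v hv => ?_
            exact_mod_cast (Finset.mem_filter.mp hv).2.le
        _ ≤ _ := h.sum_degrees_le _
    nlinarith
  have h2 := card_compl_commonNbrs_le G L δ hdeg
  rw [hL] at h2
  have h3 : (((commonNbrs G L)ᶜ).card : ℝ) + (commonNbrs G L).card = Fintype.card W := by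
    exact_mod_cast Finset.card_compl_add_card _
  have h4 : ((commonNbrs G L).card : ℝ) ≤ (commonNbrs G L \ B).card + B.card := by
    have := Finset.le_card_sdiff B (commonNbrs G L)
    exact_mod_cast (by omega)
  have h5 : m ≤ (commonNbrs G L \ B).card := by
    have h6 := mul_le_mul_of_nonneg_right hδ hn.le
    have : (m : ℝ) ≤ (commonNbrs G L \ B).card := by linarith
    exact_mod_cast this
  obtain ⟨R, hR, hRm⟩ := Finset.exists_subset_card_eq h5
  refine ⟨R, hR.trans Finset.sdiff_subset, hRm, fun r hr => ?_⟩
  have := (Finset.mem_sdiff.mp (hR hr)).2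
  simpa [B] using this

theorem one_le_lam (h : IsSparseEigenpair G γ D T lam x) : 1 ≤ lam := by
  have h1 := h.card_div_two_le
  have h2 : (2 : ℝ) * γ ≤ Fintype.card W := by exact_mod_cast h.two_mul_le_card
  have h3 : (1 : ℝ) ≤ γ := by exact_mod_cast h.one_le_gamma
  nlinarith [h.lam_nonneg]

/-! ### Gain against cost, and dominating hubs -/

/-- If making vertices twins does not increase the spectral radius, then the gain of such a
modification is bounded by its cost. -/
theorem twin_gain_le_cost (h : IsSparseEigenpair G γ D T lam x) [DecidableEq W]
    {L R : Finset W} (hL : L.card = γ) {t : ℝ} {m : ℕ} (hsmall : ∀ w ∉ L, x w < t)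
    (hDt : 4 * D * t ≤ 1) (hRm : R.card ≤ m) (hRL : R ⊆ commonNbrs G L)
    (hRd : ∀ r ∈ R, (nbrsIn G Finset.univ r).card ≤ 4 * D) {v : W} (hvL : v ∉ L) (hvR : v ∉ R)
    (hext : ∀ y : W → ℝ, ∑ u, ∑ w ∈ nbrsIn (twinGraph G L (insert v R)) Finset.univ u, y u * y w ≤
      lam * ∑ u, y u ^ 2) :
    (∑ l ∈ L, x l) ^ 2 - (lam * x v) ^ 2 +
      ∑ u ∈ L, x u * ∑ w ∈ L.erase u \ nbrsIn G Finset.univ u, x w ≤ 16 * m * γ * D * t := by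
  have hl := h.lam_pos
  have hl1 := h.one_le_lam
  have hγ : (1 : ℝ) ≤ γ := by exact_mod_cast h.one_le_gamma
  have ht : 0 ≤ t := (h.nonneg v).trans (hsmall v hvL).le
  have hadj : ∀ r ∈ R, ∀ l ∈ L, G.Adj l r := fun r hr => mem_commonNbrs.mp (hRL hr)
  have hdis : Disjoint R L := Finset.disjoint_left.mpr fun r hr hr' => (hadj r hr r hr').ne rfl
  have h1 := (twinGraph_quadratic_form_ge h.nonneg hl h.eigen L R v hdis hvL hvR hadj).trans
    (hext _)
  set g := ∑ u ∈ L, x u * ∑ w ∈ L.erase u \ nbrsIn G Finset.univ u, x w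
  have hg : 0 ≤ g := Finset.sum_nonneg fun u _ =>
    mul_nonneg (h.nonneg u) (Finset.sum_nonneg fun w _ => h.nonneg w)
  have hΛ : ∑ l ∈ L, x l ≤ γ := by
    refine (Finset.sum_le_sum fun l _ => h.le_one l).trans ?_
    simp [hL]
  have hc : ∀ r ∈ R, ∑ w ∈ nbrsIn G Finset.univ r \ L, x w ≤ 4 * D * t := by
    intro r hr
    calc _ ≤ ∑ w ∈ nbrsIn G Finset.univ r \ L, t :=
          Finset.sum_le_sum fun w hw => (hsmall w (Finset.mem_sdiff.mp hw).2).le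
      _ ≤ ∑ w ∈ nbrsIn G Finset.univ r, t :=
          Finset.sum_le_sum_of_subset_of_nonneg Finset.sdiff_subset fun _ _ _ => ht
      _ = (nbrsIn G Finset.univ r).card * t := by simp
      _ ≤ (4 * D) * t := by
          refine mul_le_mul_of_nonneg_right ?_ ht
          exact_mod_cast hRd r hr
  have hcost : lam * ∑ r ∈ R, x r * ∑ w ∈ nbrsIn G Finset.univ r \ L, x w ≤
      8 * m * γ * D * t := by
    rw [Finset.mul_sum]
    -- `lam * x r` is at most `γ` from the hubs plus `4 * D * t ≤ 1` from elsewhere.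
    calc _ ≤ ∑ r ∈ R, (2 * γ : ℝ) * (4 * D * t) := by
          refine Finset.sum_le_sum fun r hr => ?_
          rw [← mul_assoc]
          refine mul_le_mul ?_ (hc r hr) (Finset.sum_nonneg fun w _ => h.nonneg w) (by positivity)
          rw [← h.eigen r, ← Finset.sum_inter_add_sum_sdiff _ L]
          have h2 : ∑ w ∈ nbrsIn G Finset.univ r ∩ L, x w ≤ ∑ l ∈ L, x l :=
            Finset.sum_le_sum_of_subset_of_nonneg Finset.inter_subset_right
              fun w _ _ => h.nonneg w
          linarith [hc r hr]
      _ = R.card * (8 * γ * D * t) := by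
          rw [Finset.sum_const, nsmul_eq_mul]; ring
      _ ≤ m * (8 * γ * D * t) := by gcongr
      _ = _ := by ring
  set C := ∑ r ∈ R, x r * ∑ w ∈ nbrsIn G Finset.univ r \ L, x w
  have h2 : (∑ l ∈ L, x l) ^ 2 / lam - lam * x v ^ 2 + g - 2 * C ≤ 0 := by linarith
  have h3 := mul_nonpos_of_nonneg_of_nonpos hl.le h2
  have e : lam * ((∑ l ∈ L, x l) ^ 2 / lam - lam * x v ^ 2 + g - 2 * C) =
      (∑ l ∈ L, x l) ^ 2 - (lam * x v) ^ 2 + lam * g - 2 * (lam * C) := by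
    field_simp
  rw [e] at h3
  nlinarith

/-- If no modification into twins increases the spectral radius, then `γ` hubs are adjacent to all
other vertices. -/
theorem exists_dominating_of_constants (h : IsSparseEigenpair G γ D T lam x) [DecidableEq W]
    {η t : ℝ} {m q : ℕ} (hη : 0 < η) (hη1 : η ≤ 1 / 4) (ht : 0 < t)
    (h1 : 2 * (64 * (D : ℝ) ^ 3 / t ^ 2) ^ 2 ≤ Fintype.card W)
    (h2 : 2 * (64 * (D : ℝ) ^ 3 / (η / (4 * D)) ^ 2) ^ 2 ≤ Fintype.card W)
    (hq : 4 * (D : ℝ) ^ 2 / (η / (4 * D)) ≤ q)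
    (h3 : (2 ^ q * T * q : ℕ) + (γ : ℝ) ^ 2 ≤ η * Fintype.card W / 4)
    (h4 : 16 * D * (γ * (2 * η)) ≤ t) (h5 : 16 * D * (T : ℝ) ≤ t * Fintype.card W)
    (h6 : T * t ≤ 1 / 8) (h7 : (8 * (γ : ℝ) + 2) ^ 2 * D * (γ * (2 * η)) < 1 / 2)
    (h8 : γ * (2 * η) ≤ 1 / 4) (h9 : ((m + 1 : ℕ) : ℝ) ≤ Fintype.card W / 2)
    (h10 : 16 * (m + 1) * γ * D * t ≤ 1 / 4)
    (hext : ∀ (L R : Finset W) (v : W), L.card = γ → R.card = m → v ∉ L → v ∉ R →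
      R ⊆ commonNbrs G L → ∀ y : W → ℝ,
        ∑ u, ∑ w ∈ nbrsIn (twinGraph G L (insert v R)) Finset.univ u, y u * y w ≤
          lam * ∑ u, y u ^ 2) :
    ∃ L : Finset W, L.card = γ ∧ ∀ l ∈ L, ∀ v, v ≠ l → G.Adj l v := by
  have hD : (1 : ℝ) ≤ D := by exact_mod_cast h.one_le_density
  have hγ : (1 : ℝ) ≤ γ := by exact_mod_cast h.one_le_gamma
  have hm0 : (0 : ℝ) ≤ m := by positivity
  have hγDt : 16 * (γ * D * t) ≤ 1 / 4 := by
    have : 0 ≤ m * (γ * D * t) := by positivity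
    linarith
  have hmγDt : 16 * m * γ * D * t ≤ 1 / 4 - 16 * (γ * D * t) := by linarith
  have hDt : D * t ≤ γ * D * t := by nlinarith [mul_nonneg (by positivity : (0 : ℝ) ≤ D) ht.le]
  obtain ⟨L, hL, hLx⟩ := h.exists_hubs hη (by linarith) rfl (h.lam_mul_sq_ge (by positivity) h2)
    hq h3
  have hdeg := fun l hl => (hLx l hl).2
  have hsmall : ∀ w ∉ L, x w < t := fun w hw =>
    h.lt_of_notMem_hubs hL ht (h.lam_mul_sq_ge ht h1) hdeg h4 h5 hw
  obtain ⟨R, hRL, hRm, hRd⟩ := h.exists_low_degree hL hdeg h8 h9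
  have hRadj : ∀ r ∈ R, ∀ l ∈ L, G.Adj l r := fun r hr => mem_commonNbrs.mp (hRL hr)
  have hg : 0 ≤ ∑ u ∈ L, x u * ∑ w ∈ L.erase u \ nbrsIn G Finset.univ u, x w :=
    Finset.sum_nonneg fun u _ =>
      mul_nonneg (h.nonneg u) (Finset.sum_nonneg fun w _ => h.nonneg w)
  -- `R` has `m + 1` elements: `r` is spared to play the role of `v` when only an edge inside `L` is
  -- missing.
  obtain ⟨r, hr⟩ : R.Nonempty := Finset.card_pos.mp (by omega)
  have hrL : r ∉ L := fun hr' => (hRadj r hr r hr').ne rfl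
  have hRm' : (R.erase r).card = m := by rw [Finset.card_erase_of_mem hr, hRm]; rfl
  have hRL' : R.erase r ⊆ commonNbrs G L := (Finset.erase_subset _ _).trans hRL
  have hcost : ∀ v, v ∉ L → v ∉ R.erase r → (∑ l ∈ L, x l) ^ 2 - (lam * x v) ^ 2 +
      ∑ u ∈ L, x u * ∑ w ∈ L.erase u \ nbrsIn G Finset.univ u, x w ≤ 16 * m * γ * D * t :=
    fun v hvL hvR => h.twin_gain_le_cost hL hsmall (by linarith) hRm'.le hRL'
      (fun z hz => hRd z (Finset.mem_of_mem_erase hz)) hvL hvR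
      (hext L _ v hL hRm' hvL hvR hRL')
  refine ⟨L, hL, ?_⟩
  by_cases hE : ((commonNbrs G L)ᶜ \ L).Nonempty
  · exfalso
    obtain ⟨v, hvE, hv⟩ := h.exists_light_exceptional hL ht hdeg hsmall h6 h7 hE
    rw [Finset.mem_sdiff, Finset.mem_compl] at hvE
    have key := hcost v hvE.2 fun hv' => hvE.1 (hRL' hv')
    obtain ⟨l, hl, hlv⟩ : ∃ l ∈ L, ¬ G.Adj l v := by simpa using hvE.1
    -- Missing a hub costs at least 3/4, while the weight outside `L` returns at most 1/4. Joining
    -- `v` to all of `L` then gains at least 1/2 in the squares, more than the cost.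
    have e1 : lam * x v ≤ ∑ l ∈ L, x l - 1 / 2 := by
      rw [← h.eigen v, ← Finset.sum_inter_add_sum_sdiff _ L]
      have e2 : ∑ w ∈ nbrsIn G Finset.univ v ∩ L, x w ≤ ∑ w ∈ L.erase l, x w := by
        refine Finset.sum_le_sum_of_subset_of_nonneg (fun w hw => ?_) fun w _ _ => h.nonneg w
        simp only [Finset.mem_inter, mem_nbrsIn, Finset.mem_erase] at hw ⊢
        exact ⟨fun h => hlv (h ▸ hw.1.2.symm), hw.2⟩
      have e3 := Finset.add_sum_erase L x hl
      linarith [(hLx l hl).1]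
    have e4 : 0 ≤ lam * x v := mul_nonneg h.lam_nonneg (h.nonneg v)
    have e5 : 3 / 4 ≤ ∑ l ∈ L, x l := by
      have := Finset.single_le_sum (fun w _ => h.nonneg w) hl
      linarith [(hLx l hl).1]
    have e6 : 0 ≤ γ * D * t := by positivity
    nlinarith
  · intro l hl v hvl
    rw [Finset.not_nonempty_iff_eq_empty] at hE
    by_cases hvL : v ∈ L
    · by_contra hlv
      have key := hcost r hrL (by simp)
      -- The missing edge between two hubs of entry at least 3/4 is the gain; making `r` a twin
      -- loses only order `γ * D * t`.
      have e1 : 9 / 16 ≤ ∑ u ∈ L, x u * ∑ w ∈ L.erase u \ nbrsIn G Finset.univ u, x w := by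
        have s1 := Finset.single_le_sum (s := L)
          (f := fun u => x u * ∑ w ∈ L.erase u \ nbrsIn G Finset.univ u, x w)
          (fun u _ => mul_nonneg (h.nonneg u) (Finset.sum_nonneg fun w _ => h.nonneg w)) hl
        have s2 := Finset.single_le_sum (s := L.erase l \ nbrsIn G Finset.univ l) (f := x)
          (fun w _ => h.nonneg w) (a := v) (by simp [hvl, hvL, hlv])
        have s3 := (hLx l hl).1
        have s4 := (hLx v hvL).1
        have s5 : 3 / 4 * (3 / 4) ≤ x l * ∑ w ∈ L.erase l \ nbrsIn G Finset.univ l, x w :=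
          mul_le_mul (by linarith) (by linarith) (by norm_num) (h.nonneg l)
        linarith
      have e2 : lam * x r ≤ ∑ l ∈ L, x l + 4 * (D * t) := by
        rw [← h.eigen r, ← Finset.sum_inter_add_sum_sdiff _ L]
        refine add_le_add (Finset.sum_le_sum_of_subset_of_nonneg Finset.inter_subset_right
          fun w _ _ => h.nonneg w) ?_
        calc _ ≤ ∑ w ∈ nbrsIn G Finset.univ r \ L, t :=
              Finset.sum_le_sum fun w hw => (hsmall w (Finset.mem_sdiff.mp hw).2).le
          _ ≤ ∑ w ∈ nbrsIn G Finset.univ r, t :=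
              Finset.sum_le_sum_of_subset_of_nonneg Finset.sdiff_subset fun _ _ _ => ht.le
          _ = (nbrsIn G Finset.univ r).card * t := by simp
          _ ≤ ((4 * D : ℕ) : ℝ) * t :=
              mul_le_mul_of_nonneg_right (by exact_mod_cast hRd r hr) ht.le
          _ = _ := by push_cast; ring
      have e3 : ∑ l ∈ L, x l ≤ γ := by
        refine (Finset.sum_le_sum fun l _ => h.le_one l).trans ?_
        simp [hL]
      have e4 : 0 ≤ lam * x r := mul_nonneg h.lam_nonneg (h.nonneg r)
      have e5 : 0 ≤ D * t := by positivity
      have e6 : (lam * x r) ^ 2 ≤ (∑ l ∈ L, x l + 4 * (D * t)) ^ 2 := by gcongr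
      have e7 : (∑ l ∈ L, x l) * (D * t) ≤ γ * (D * t) := by gcongr
      have e8 : (D * t) * (D * t) ≤ 1 * (D * t) := by
        gcongr; linarith
      nlinarith
    · have : v ∈ commonNbrs G L := by
        by_contra hv
        have : v ∈ (commonNbrs G L)ᶜ \ L := by simp only [Finset.mem_sdiff, Finset.mem_compl]; tauto
        rw [hE] at this
        simp at this
      exact mem_commonNbrs.mp this l hl

end IsSparseEigenpair

/-- For large graphs, if no modification into twins increases the spectral radius, then `γ` hubs
are adjacent to all other vertices. -/
theorem exists_dominating_of_extremal (γ D T m : ℕ) : ∃ N : ℕ, ∀ {W : Type*} [Fintype W]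
    [DecidableEq W] {G : SimpleGraph W} {lam : ℝ} {x : W → ℝ}, N ≤ Fintype.card W →
    IsSparseEigenpair G γ D T lam x →
    (∀ (L R : Finset W) (v : W), L.card = γ → R.card = m → v ∉ L → v ∉ R →
      R ⊆ commonNbrs G L → ∀ y : W → ℝ,
        ∑ u, ∑ w ∈ nbrsIn (twinGraph G L (insert v R)) Finset.univ u, y u * y w ≤
          lam * ∑ u, y u ^ 2) →
    ∃ L : Finset W, L.card = γ ∧ ∀ l ∈ L, ∀ v, v ≠ l → G.Adj l v := by
  -- Order of choice: `t` bounds the cost, `η` is much smaller than `t` so that few vertices escape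
  -- the hubs, then `q`, and finally the number of vertices.
  let t : ℝ := 1 / (64 * (m + 1) * (γ + 1) * (D + 1) * (T + 1))
  have ht : 0 < t := by positivity
  let η : ℝ := t / (400 * (γ + 1) ^ 3 * (D + 1))
  have hη : 0 < η := by positivity
  obtain ⟨q, hq⟩ := exists_nat_ge (4 * (D : ℝ) ^ 2 / (η / (4 * D)))
  obtain ⟨N1, hN1⟩ := exists_nat_ge (2 * (64 * (D : ℝ) ^ 3 / t ^ 2) ^ 2)
  obtain ⟨N2, hN2⟩ := exists_nat_ge (2 * (64 * (D : ℝ) ^ 3 / (η / (4 * D)) ^ 2) ^ 2)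
  obtain ⟨N3, hN3⟩ := exists_nat_ge ((((2 ^ q * T * q : ℕ) : ℝ) + (γ : ℝ) ^ 2) * 4 / η)
  obtain ⟨N4, hN4⟩ := exists_nat_ge (16 * D * (T : ℝ) / t)
  refine ⟨N1 + N2 + N3 + N4 + 2 * (m + 1), fun {W} _ _ {G lam x} hN h hext => ?_⟩
  have hle : ∀ k : ℕ, k ≤ N1 + N2 + N3 + N4 + 2 * (m + 1) → (k : ℝ) ≤ Fintype.card W :=
    fun k hk => by exact_mod_cast hk.trans hN
  have hγ : (1 : ℝ) ≤ γ := by exact_mod_cast h.one_le_gamma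
  have hD : (1 : ℝ) ≤ D := by exact_mod_cast h.one_le_density
  have ht1 : 64 * (m + 1) * (γ + 1) * (D + 1) * (T + 1) * t = 1 := by
    simp only [t]; field_simp
  have hη1 : 400 * (γ + 1) ^ 3 * (D + 1) * η = t := by
    simp only [η]; field_simp
  have hm0 : (0 : ℝ) ≤ m := by positivity
  have hT0 : (0 : ℝ) ≤ T := by positivity
  have hA1 : 1 ≤ 64 * ((m : ℝ) + 1) * (γ + 1) * (D + 1) * (T + 1) := by
    have a1 : (1 : ℝ) ≤ m + 1 := by linarith
    have a2 : (1 : ℝ) ≤ γ + 1 := by linarith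
    have a3 : (1 : ℝ) ≤ D + 1 := by linarith
    have a4 : (1 : ℝ) ≤ T + 1 := by linarith
    calc (1 : ℝ) ≤ 64 * 1 * 1 * 1 * 1 := by norm_num
      _ ≤ _ := by gcongr
  have htle : t ≤ 1 := by
    rw [← ht1]
    exact le_mul_of_one_le_left ht.le hA1
  have hb : ∀ a : ℝ, a ≤ 400 * (γ + 1) ^ 3 * (D + 1) → a * η ≤ t := fun a ha => by
    rw [← hη1]
    exact mul_le_mul_of_nonneg_right ha hη.le
  have hc : ∀ a : ℝ, a ≤ 64 * (m + 1) * (γ + 1) * (D + 1) * (T + 1) → a * t ≤ 1 := fun a ha => by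
    rw [← ht1]
    exact mul_le_mul_of_nonneg_right ha ht.le
  have p1 : (1 : ℝ) ≤ (γ + 1) ^ 3 * (D + 1) := by
    have a2 : (1 : ℝ) ≤ γ + 1 := by linarith
    have a3 : (1 : ℝ) ≤ D + 1 := by linarith
    calc (1 : ℝ) = 1 ^ 3 * 1 := by norm_num
      _ ≤ _ := by gcongr
  have p2 : (γ : ℝ) * D ≤ (γ + 1) ^ 3 * (D + 1) := by
    have a3 : (D : ℝ) ≤ D + 1 := by linarith
    have a2 : (γ : ℝ) ≤ (γ + 1) ^ 3 := by nlinarith [sq_nonneg (γ : ℝ)]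
    gcongr
  have p3 : (γ : ℝ) ≤ γ * D := le_mul_of_one_le_right (by linarith) hD
  have p4 : (8 * (γ : ℝ) + 2) ^ 2 * D * γ ≤ 64 * ((γ + 1) ^ 3 * (D + 1)) := by
    calc (8 * (γ : ℝ) + 2) ^ 2 * D * γ ≤ (8 * (γ + 1)) ^ 2 * (D + 1) * (γ + 1) := by
          gcongr <;> linarith
      _ = _ := by ring
  refine h.exists_dominating_of_constants (m := m) hη ?_ ht (hN1.trans (hle _ (by omega)))
    (hN2.trans (hle _ (by omega))) hq ?_ ?_ ?_ ?_ ?_ ?_ ?_ ?_ hext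
  · have := hb 4 (by linarith)
    linarith
  · have := hN3.trans (hle _ (by omega))
    rw [div_le_iff₀ hη] at this
    linarith
  · have := hb (32 * (γ * D)) (by linarith)
    linarith
  · have := hN4.trans (hle _ (by omega))
    rw [div_le_iff₀ ht] at this
    linarith
  · have := hc (8 * T) ?_
    · linarith
    · calc (8 : ℝ) * T ≤ 64 * 1 * 1 * 1 * (T + 1) := by linarith
        _ ≤ _ := by gcongr <;> linarith
  · have := hb (5 * ((8 * (γ : ℝ) + 2) ^ 2 * D * γ)) (by linarith)
    linarith
  · have := hb (8 * γ) (by linarith)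
    linarith
  · have := hle (2 * (m + 1)) (by omega)
    push_cast at this ⊢
    linarith
  · have := hc (64 * (m + 1) * γ * D) ?_
    · linarith
    · calc 64 * ((m : ℝ) + 1) * γ * D = 64 * (m + 1) * γ * D * 1 := by ring
        _ ≤ _ := by gcongr <;> linarith

/-! ### The book as competitor, and the main theorem -/

/-- The spectral radius of a generalized book. -/
theorem sqrt_mul_sqrt_le_rho_twinGraph_bot {W : Type*} [Fintype W] [Nonempty W] [DecidableEq W]
    (L : Finset W) (hL : L.Nonempty) (hLc : Lᶜ.Nonempty) :
    √(Lᶜ.card : ℝ) * √(L.card : ℝ) ≤ (rho (twinGraph (⊥ : SimpleGraph W) L Lᶜ)).toReal := by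
  set G := twinGraph (⊥ : SimpleGraph W) L Lᶜ
  set a := √(Lᶜ.card : ℝ)
  set b := √(L.card : ℝ)
  have ha : a ^ 2 = Lᶜ.card := Real.sq_sqrt (by positivity)
  have hb : b ^ 2 = L.card := Real.sq_sqrt (by positivity)
  have hL0 : (0 : ℝ) < L.card := by exact_mod_cast hL.card_pos
  have hLc0 : (0 : ℝ) < Lᶜ.card := by exact_mod_cast hLc.card_pos
  -- The Perron vector of the complete bipartite graph between `L` and its complement; edges inside
  -- `L` are ignored.
  let y : W → ℝ := fun u => if u ∈ L then a else b
  have hy0 : ∀ u, 0 ≤ y u := fun u => by simp only [y]; split_ifs <;> positivity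
  have hyL : ∀ u ∈ L, y u = a := fun u hu => if_pos hu
  have hyLc : ∀ u ∈ Lᶜ, y u = b := fun u hu => if_neg (Finset.mem_compl.mp hu)
  have h1 : ∑ u, y u ^ 2 = 2 * (L.card * Lᶜ.card) := by
    have e1 : ∑ u ∈ L, y u ^ 2 = ∑ u ∈ L, (Lᶜ.card : ℝ) :=
      Finset.sum_congr rfl fun u hu => by rw [hyL u hu, ha]
    have e2 : ∑ u ∈ Lᶜ, y u ^ 2 = ∑ u ∈ Lᶜ, (L.card : ℝ) :=
      Finset.sum_congr rfl fun u hu => by rw [hyLc u hu, hb]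
    rw [← Finset.sum_add_sum_compl L, e1, e2]
    simp only [Finset.sum_const, nsmul_eq_mul]
    ring
  have h2 : 2 * (L.card * Lᶜ.card) * (a * b) ≤
      ∑ u, ∑ w ∈ nbrsIn G Finset.univ u, y u * y w := by
    have hsub : ∀ S : Finset W, ∀ u, (∀ w ∈ S, G.Adj u w) →
        ∑ w ∈ S, y u * y w ≤ ∑ w ∈ nbrsIn G Finset.univ u, y u * y w := fun S u hS =>
      Finset.sum_le_sum_of_subset_of_nonneg (fun w hw => by simp [hS w hw])
        fun w _ _ => mul_nonneg (hy0 u) (hy0 w)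
    have e1 : L.card * (Lᶜ.card * (a * b)) ≤
        ∑ u ∈ L, ∑ w ∈ nbrsIn G Finset.univ u, y u * y w := by
      rw [← nsmul_eq_mul]
      refine Finset.card_nsmul_le_sum _ _ _ fun u hu => ?_
      refine le_trans (le_of_eq ?_) (hsub Lᶜ u fun w hw => ?_)
      · rw [Finset.sum_congr rfl fun w hw => by rw [hyLc w hw, hyL u hu], Finset.sum_const,
          nsmul_eq_mul]
      · refine twinGraph_adj.mpr ⟨fun h => ?_, Or.inr (Or.inr (Or.inl ⟨hu, hw⟩))⟩
        exact Finset.mem_compl.mp hw (h ▸ hu)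
    have e2 : Lᶜ.card * (L.card * (a * b)) ≤
        ∑ u ∈ Lᶜ, ∑ w ∈ nbrsIn G Finset.univ u, y u * y w := by
      rw [← nsmul_eq_mul]
      refine Finset.card_nsmul_le_sum _ _ _ fun u hu => ?_
      refine le_trans (le_of_eq ?_) (hsub L u fun w hw => ?_)
      · rw [Finset.sum_congr rfl fun w hw => by rw [hyL w hw, hyLc u hu], Finset.sum_const,
          nsmul_eq_mul, mul_comm b a]
      · refine twinGraph_adj.mpr ⟨fun h => ?_, Or.inr (Or.inl ⟨hu, hw⟩)⟩
        exact Finset.mem_compl.mp hu (h ▸ hw)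
    rw [← Finset.sum_add_sum_compl L]
    linarith
  have h3 := h2.trans (sum_mul_le_rho_mul_sum_sq G y)
  rw [h1] at h3
  have : 0 < 2 * ((L.card : ℝ) * Lᶜ.card) := by positivity
  nlinarith

/-- `L` is a vertex cover, one vertex too small for `H`. Nonemptiness of `L` excludes the truncated
value of `gammaGraph`. -/
theorem not_containsSubdivision_twinGraph_bot {V W : Type*} [Fintype V] [Fintype W]
    [DecidableEq W] {H : SimpleGraph V} (L : Finset W) (hL : 1 ≤ L.card)
    (hH : L.card ≤ gammaGraph H) :
    ¬ ContainsSubdivision H (twinGraph (⊥ : SimpleGraph W) L Lᶜ) := by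
  intro h
  have := h.card_le_indepNum_add_card L fun u v huv => by
    have := (twinGraph_adj.mp huv).2
    rw [SimpleGraph.bot_adj] at this
    tauto
  unfold gammaGraph at hH
  omega

/-- A graph with `γ_H + 1` vertices that have many common neighbours contains a subdivision
of `H`. -/
theorem card_lt_of_not_containsSubdivision {V W : Type*} [Fintype V] {H : SimpleGraph V}
    {G : SimpleGraph W} (hG : ¬ ContainsSubdivision H G) (hH : 1 ≤ gammaGraph H)
    (L S : Finset W) (hL : L.card = gammaGraph H + 1) (hS : ∀ s ∈ S, ∀ l ∈ L, G.Adj l s) :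
    S.card < Fintype.card (V ⊕ Sym2 V) := by
  classical
  by_contra! hcard
  -- The complement of a maximum independent set is a vertex cover with `γ_H + 1` elements, as many
  -- as `L`.
  obtain ⟨s, hs, hsc⟩ := H.exists_isNIndepSet_indepNum
  have hC : sᶜ.card = L.card := by
    rw [Finset.card_compl, hsc, hL]
    unfold gammaGraph at hH ⊢
    omega
  obtain ⟨l0, hl0⟩ : L.Nonempty := Finset.card_pos.mp (by omega)
  let e := Finset.equivOfCardEq hC
  let φ : V → W := fun v => if h : v ∈ sᶜ then e ⟨v, h⟩ else l0
  have hφL : ∀ v, φ v ∈ L := by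
    intro v
    simp only [φ]
    split_ifs
    · exact (e _).2
    · exact hl0
  refine hG (containsSubdivision_of_common_neighbors sᶜ ?_ φ ?_ S (fun z hz c _ => hS z hz _ (hφL c))
    hcard)
  · intro u v huv
    by_contra! hcon
    simp only [Finset.mem_compl, not_not] at hcon
    exact hs hcon.1 hcon.2 huv.ne huv
  · intro u hu v hv huv
    rw [Finset.mem_coe] at hu hv
    simp only [φ, dif_pos hu, dif_pos hv] at huv
    simpa using e.injective (Subtype.ext huv)

/-- A graph with a set of `s` vertices that are adjacent to all other vertices has a generalized
book as a spanning subgraph. -/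
theorem exists_generalizedBook_iso_le {n s : ℕ} (G : SimpleGraph (Fin n)) (L : Finset (Fin n))
    (hL : L.card = s) (hadj : ∀ l ∈ L, ∀ v, v ≠ l → G.Adj l v) :
    ∃ K : SimpleGraph (Fin n), K ≤ G ∧ Nonempty (generalizedBook s (n - s) ≃g K) := by
  let e1 : Fin s ≃ {v // v ∈ L} := (Finset.equivFinOfCardEq hL).symm
  let e2 : Fin (n - s) ≃ {v // v ∉ L} := (Fintype.equivFinOfCardEq (by
    rw [Fintype.card_subtype_compl, Fintype.card_fin, Fintype.card_coe, hL])).symm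
  let e : Fin s ⊕ Fin (n - s) ≃ Fin n := (Equiv.sumCongr e1 e2).trans (Equiv.sumCompl (· ∈ L))
  refine ⟨(generalizedBook s (n - s)).map e.toEmbedding, ?_, ⟨SimpleGraph.Iso.map e _⟩⟩
  rw [SimpleGraph.map_le_iff_le_comap]
  have hinl : ∀ i, e (Sum.inl i) ∈ L := fun i => (e1 i).2
  intro u v huv
  have hne : e u ≠ e v := fun h => huv.ne (e.injective h)
  change G.Adj (e u) (e v)
  rcases u with i | i
  · exact hadj _ (hinl i) _ hne.symm
  · rcases v with j | j
    · exact (hadj _ (hinl j) _ hne).symm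
    · simp [generalizedBook] at huv

end SubdivSpectral

open SubdivSpectral in
theorem theorem1p3 {ι : Type*} [Finite ι] {V : ι → Type*} [∀ i, Fintype (V i)]
    (H : ∀ i, SimpleGraph (V i)) (hγ : 1 ≤ SubdivSpectral.gammaFamily H) :
    ∃ N : ℕ, ∀ n : ℕ, N ≤ n → ∀ G : SimpleGraph (Fin n),
      SubdivSpectral.IsSpectralExtremal H G →
        ∃ K : SimpleGraph (Fin n), K ≤ G ∧
          Nonempty (SubdivSpectral.generalizedBook (SubdivSpectral.gammaFamily H)
            (n - SubdivSpectral.gammaFamily H) ≃g K) := by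
  classical
  set γ := gammaFamily H with hγdef
  -- An empty family has `gammaFamily` equal to 0, so `hγ` already excludes it.
  have hne : (Set.range fun i => gammaGraph (H i)).Nonempty := by
    rw [Set.nonempty_iff_ne_empty]
    intro h
    rw [hγdef, gammaFamily, h, Nat.sInf_empty] at hγ
    omega
  obtain ⟨i₀, hi₀⟩ : ∃ i, gammaGraph (H i) = γ := Nat.sInf_mem hne
  have hmin : ∀ i, γ ≤ gammaGraph (H i) := fun i => Nat.sInf_le ⟨i, rfl⟩
  obtain ⟨D, hD⟩ := exists_adjCount_le_of_not_containsSubdivision (H i₀)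
  -- One size of `R` that suffices for rerouting subdivisions of every member; finiteness of the
  -- family is used here.
  obtain ⟨m, hm⟩ := (Set.finite_range fun i => Fintype.card (V i) +
    Fintype.card (V i × V i) * (γ + 1) + Fintype.card (Sym2 (V i)) * (γ * γ)).bddAbove
  obtain ⟨N, hN⟩ := exists_dominating_of_extremal γ (D + 1)
    (Fintype.card (V i₀ ⊕ Sym2 (V i₀))) m
  refine ⟨N + 2 * γ, fun n hn G hG => ?_⟩
  have : Nonempty (Fin n) := ⟨⟨0, by omega⟩⟩
  have hmono : ∀ G' : SimpleGraph (Fin n), SubdivisionFree H G' →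
      (rho G').toReal ≤ (rho G).toReal :=
    fun G' hG' => ENNReal.toReal_mono (rho_ne_top G) (hG.2 G' hG')
  obtain ⟨x, hx0, hx1, hxe, heig⟩ := exists_nonneg_eigenvector G
  have hpair : IsSparseEigenpair G γ (D + 1) (Fintype.card (V i₀ ⊕ Sym2 (V i₀)))
      (rho G).toReal x := by
    refine ⟨hx0, hx1, hxe, heig, fun S => ?_, fun L S hL hS => ?_, ENNReal.toReal_nonneg, ?_, hγ,
      by omega, by rw [Fintype.card_fin]; omega⟩
    · exact (hD G (hG.1 i₀) S).trans (Nat.mul_le_mul_right _ (Nat.le_succ D))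
    · exact card_lt_of_not_containsSubdivision (hG.1 i₀) (by omega) L S (by omega) hS
    -- The lower bound on the spectral radius comes from comparison with the book on `L`.
    · obtain ⟨L, -, hL⟩ := Finset.exists_subset_card_eq (s := (Finset.univ : Finset (Fin n)))
        (n := γ) (by rw [Finset.card_univ, Fintype.card_fin]; omega)
      have hLc : Lᶜ.card = n - γ := by rw [Finset.card_compl, Fintype.card_fin, hL]
      have hfree : SubdivisionFree H (twinGraph (⊥ : SimpleGraph (Fin n)) L Lᶜ) := fun i =>
        not_containsSubdivision_twinGraph_bot L (by omega) (by rw [hL]; exact hmin i)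
      have h1 := (sqrt_mul_sqrt_le_rho_twinGraph_bot L (Finset.card_pos.mp (by omega))
        (Finset.card_pos.mp (by omega))).trans (hmono _ hfree)
      have h2 := pow_le_pow_left₀ (by positivity) h1 2
      rw [mul_pow, Real.sq_sqrt (by positivity), Real.sq_sqrt (by positivity), hL, hLc,
        Nat.cast_sub (by omega)] at h2
      rw [Fintype.card_fin]
      linarith
  obtain ⟨L, hL, hadj⟩ := hN (by rw [Fintype.card_fin]; omega) hpair
    fun L R v hL hR hvL hvR hRL y => by
      have hRadj : ∀ r ∈ R, ∀ u ∈ L, G.Adj u r := fun r hr => mem_commonNbrs.mp (hRL hr)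
      have hdis : Disjoint (insert v R) L := by
        rw [Finset.disjoint_insert_left, Finset.disjoint_left]
        exact ⟨hvL, fun r hr hr' => (hRadj r hr r hr').ne rfl⟩
      have hfree : SubdivisionFree H (twinGraph G L (insert v R)) := by
        intro i hi
        refine hG.1 i (hi.of_twins L (insert v R) R (Finset.subset_insert _ _) hdis hRadj ?_ ?_ ?_)
        · intro u w huw hu
          have h1 := (twinGraph_adj.mp huw).2
          have h2 := Finset.disjoint_left.mp hdis hu
          tauto
        · intro u w huw hu hw
          have h1 := (twinGraph_adj.mp huw).2
          tauto
        · rw [hL, hR]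
          exact hm ⟨i, rfl⟩
      exact (sum_mul_le_rho_mul_sum_sq _ y).trans
        (mul_le_mul_of_nonneg_right (hmono _ hfree) (Finset.sum_nonneg fun u _ => sq_nonneg _))
  exact exists_generalizedBook_iso_le G L hL hadj
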